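/- Let $(K,\delta)$ be a differential field of characteristic $0$ which is differentially large: $K$ is large (every $K$-irreducible variety over $K$ with a smooth $K$-point has a Zariski-dense set of $K$-points), and whenever $K$ is existentially closed, as a field, in a differential field extension $L$ of $K$, it is existentially closed in $L$ as a differential field. Let $(\mathcal U,\delta)$ be a differentially closed field extending $(K,\delta)$. For a variety $X$ over $K$ let $\tau(X)$ be its prolongation, given on a $K$-algebra $R$ by $\tau(X)(R)=\operatorname{Hom}_K(\operatorname{Spec}R[\varepsilon],X)$, where $\varepsilon^2=0$ and $K$ acts on $R[\varepsilon]$ through $c\mapsto c+\delta(c)\varepsilon$; let $\pi:\tau(X)\to X$ be the projection and $\nabla:X(\mathcal U)\to\tau(X)(\mathcal U)$ the map induced by $r\mapsto r+\delta(r)\varepsilon$ (in affine coordinates, $a\mapsto(a,\delta(a))$). Let $(G,s_G)$ be an algebraic D-group over $K$, i.e. an algebraic group $G$ over $K$ with a section $s_G:G\to\tau(G)$ of $\pi$ over $K$ which is a homomorphism. Let $(X,s_X)$ and $(Y,s_Y)$ be D-torsors for $(G,s_G)$ over $K$, i.e. algebraic torsors (principal homogeneous spaces) $X,Y$ for $G$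 over $K$ with sections $s_X:X\to\tau(X)$, $s_Y:Y\to\tau(Y)$ of the projections over $K$ such that $s_X(g\cdot x)=s_G(g)\cdot s_X(x)$ and $s_Y(g\cdot y)=s_G(g)\cdot s_Y(y)$. Write $X^\sharp=\{a\in X(\mathcal U): s_X(a)=\nabla(a)\}$, and similarly $Y^\sharp$ and $G^\sharp$. If there is an isomorphism of varieties $f:X\to Y$ defined over $K$ with $f(g\cdot x)=g\cdot f(x)$, then there is a differential $G^\sharp$-isomorphism $X^\sharp\to Y^\sharp$ defined over $K$: a bijection $g:X^\sharp\to Y^\sharp$ with $g(\gamma\cdot x)=\gamma\cdot g(x)$ for all $\gamma\in G^\sharp$, $x\in X^\sharp$, such that $g$ and $g^{-1}$ are differential morphisms over $K$, that is, are continuous for the Kolchin topology over $K$ and are locally, for that topology, given in affine charts over $K$ by quotients of differential polynomials over $K$. -/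

import Mathlib

open CategoryTheory AlgebraicGeometry
open scoped Differential MonObj

universe u

noncomputable section

namespace DiffAlg

/-! ## Differential polynomials, existential closedness -/

/-- The value at the tuple `a` of the differential polynomial `P`, where the variable `(i, j)` of
`P` stands for the `j`-th derivative of the `i`-th differential indeterminate. -/
def diffEval {K A : Type u} [Field K] [CommRing A] [Algebra K A] [Differential A] {n : ℕ}
    (a : Fin n → A) (P : MvPolynomial (Fin n × ℕ) K) : A :=
  MvPolynomial.aeval (fun p : Fin n × ℕ => (fun x : A => x′)^[p.2] (a p.1)) P

/-- `K` is existentially closed in the extension `L` as a field: every finite system of polynomial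
equations and inequations over `K` that has a solution in `L` has one in `K`. -/
def IsFieldEC (K L : Type u) [Field K] [Field L] [Algebra K L] : Prop :=
  ∀ (n : ℕ) (E I : Finset (MvPolynomial (Fin n) K)),
    (∃ a : Fin n → L, (∀ P ∈ E, MvPolynomial.aeval a P = 0) ∧
      ∀ Q ∈ I, MvPolynomial.aeval a Q ≠ 0) →
    ∃ a : Fin n → K, (∀ P ∈ E, MvPolynomial.aeval a P = 0) ∧
      ∀ Q ∈ I, MvPolynomial.aeval a Q ≠ 0

/-- `K` is existentially closed in the extension `L` as a differential field: every finite system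
of differential polynomial equations and inequations over `K` that has a solution in `L` has one
in `K`. -/
def IsDiffEC (K L : Type u) [Field K] [Differential K] [Field L] [Differential L]
    [Algebra K L] : Prop :=
  ∀ (n : ℕ) (E I : Finset (MvPolynomial (Fin n × ℕ) K)),
    (∃ a : Fin n → L, (∀ P ∈ E, diffEval a P = 0) ∧ ∀ Q ∈ I, diffEval a Q ≠ 0) →
    ∃ a : Fin n → K, (∀ P ∈ E, diffEval a P = 0) ∧ ∀ Q ∈ I, diffEval a Q ≠ 0

/-- A differentially closed field: a differential field that is existentially closed in all its
differential field extensions. (In characteristic zero these are the models of `DCF₀`.) -/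
def IsDifferentiallyClosed (U : Type u) [Field U] [Differential U] : Prop :=
  ∀ (L : Type u) [Field L] [Differential L] [Algebra U L] [DifferentialAlgebra U L], IsDiffEC U L

/-! ## Varieties and their points -/

section Points

variable (K : Type u) [Field K]

/-- The `K`-scheme `Spec R` attached to a `K`-algebra `R`. The morphisms `specOver K R ⟶ X` are the
`R`-points of the `K`-scheme `X`. -/
abbrev specOver (R : Type u) [CommRing R] [Algebra K R] : Over (Spec (CommRingCat.of K)) :=
  Over.mk (Spec.map (CommRingCat.ofHom (algebraMap K R)))

variable {K}

/-- The morphism of `K`-schemes `Spec R' ⟶ Spec R` attached to a homomorphism of `K`-algebras. -/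
def specMap {R R' : Type u} [CommRing R] [Algebra K R] [CommRing R'] [Algebra K R']
    (φ : R →ₐ[K] R') : specOver K R' ⟶ specOver K R :=
  Over.homMk (Spec.map (CommRingCat.ofHom φ.toRingHom)) (by
    simp only [Over.mk_left, Over.mk_hom, ← Spec.map_comp, ← CommRingCat.ofHom_comp]
    congr 2
    exact φ.comp_algebraMap)

/-- Algebraic varieties over `K`: reduced separated schemes of finite type over `K`, possibly
reducible. -/
structure IsVariety (X : Over (Spec (CommRingCat.of K))) : Prop where
  isReduced : IsReduced X.left
  locallyOfFiniteType : LocallyOfFiniteType X.hom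
  quasiCompact : QuasiCompact X.hom
  isSeparated : IsSeparated X.hom

/-- The point of the underlying space of `X` at which an `R`-point is located, `R` a field. -/
def location {X : Over (Spec (CommRingCat.of K))} {R : Type u} [Field R] [Algebra K R]
    (a : specOver K R ⟶ X) : X.left :=
  a.left (IsLocalRing.closedPoint R)

/-- The `R`-point `a` lies in the open subscheme `W` of `X`. -/
def LiesIn {X : Over (Spec (CommRingCat.of K))} {R : Type u} [CommRing R] [Algebra K R]
    (a : specOver K R ⟶ X) (W : X.left.Opens) : Prop :=
  ⊤ ≤ a.left ⁻¹ᵁ W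

/-- The value in `R` of the regular function `h` on `W` at an `R`-point lying in `W`. -/
def valueAt {X : Over (Spec (CommRingCat.of K))} {R : Type u} [CommRing R] [Algebra K R]
    (a : specOver K R ⟶ X) (W : X.left.Opens) (ha : LiesIn a W) (h : Γ(X.left, W)) : R :=
  (Scheme.ΓSpecIso (CommRingCat.of R)).hom (a.left.appLE W ⊤ ha h)

variable (K)

/-- A large field: every `K`-irreducible variety over `K` with a smooth `K`-point has a
Zariski-dense set of `K`-points. -/
def IsLarge : Prop :=
  ∀ V : Over (Spec (CommRingCat.of K)), IsVariety V → IrreducibleSpace V.left →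
    (∃ (p : specOver K K ⟶ V) (W : V.left.Opens), location p ∈ W ∧ Smooth (W.ι ≫ V.hom)) →
    Dense (Set.range (location : (specOver K K ⟶ V) → V.left))

/-- A differentially large field: `K` is large, and whenever `K` is existentially closed as a field
in a differential field extension `L`, it is so as a differential field. -/
def IsDifferentiallyLarge [Differential K] : Prop :=
  IsLarge K ∧
    ∀ (L : Type u) [Field L] [Differential L] [Algebra K L] [DifferentialAlgebra K L],
      IsFieldEC K L → IsDiffEC K L

end Points

/-! ## Prolongations -/

section Prolongation

variable (K : Type u) [Field K] [Differential K]

/-- The homomorphism `K → R[ε]`, `c ↦ c + δ(c) ε`, for a `K`-algebra `R`. -/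
def twist (R : Type u) [CommRing R] [Algebra K R] : K →+* DualNumber R where
  toFun c := TrivSqZeroExt.inl (algebraMap K R c) + TrivSqZeroExt.inr (algebraMap K R c′)
  map_one' := by ext <;> simp
  map_zero' := by ext <;> simp
  map_add' a b := by
    ext
    · simp
    · simp only [TrivSqZeroExt.snd_add, TrivSqZeroExt.snd_inl, TrivSqZeroExt.snd_inr, map_add]
      ring
  map_mul' a b := by
    ext
    · simp
    · simp only [TrivSqZeroExt.snd_add, TrivSqZeroExt.snd_inl, TrivSqZeroExt.snd_inr,
        TrivSqZeroExt.snd_mul, TrivSqZeroExt.fst_add, TrivSqZeroExt.fst_inl,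
        TrivSqZeroExt.fst_inr, Derivation.leibniz, smul_eq_mul, map_add, map_mul,
        MulOpposite.smul_eq_mul_unop, MulOpposite.unop_op]
      ring

/-- `Spec R[ε]`, seen as a `K`-scheme through `c ↦ c + δ(c) ε`. -/
abbrev prolongSpec (R : Type u) [CommRing R] [Algebra K R] : Over (Spec (CommRingCat.of K)) :=
  Over.mk (Spec.map (CommRingCat.ofHom (twist K R)))

variable {K}

/-- The `R`-points of the prolongation `τ(X)`, for a `K`-algebra `R`: the morphisms of `K`-schemes
`Spec R[ε] ⟶ X`, where `K` acts on `R[ε]` through `c ↦ c + δ(c) ε`. So `τ(X)` is given by its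
functor of points, as the Weil descent along the dual numbers of the base change of `X` along
`c ↦ c + δ(c) ε`. If `X ⊆ 𝔸ⁿ` is the zero set of polynomials `Pᵢ`, such a morphism is a tuple
`x + u ε` with `Pᵢ^{twisted}(x + u ε) = 0`, that is, `Pᵢ(x) = 0` and
`∑ⱼ (∂Pᵢ/∂xⱼ)(x) uⱼ + Pᵢ^δ(x) = 0`.

If `G` is a group scheme, `τ(G)(R)` is a group; if `G` acts on `X`, then `τ(G)(R)` acts
on `τ(X)(R)`. -/
abbrev TauPoint (X : Over (Spec (CommRingCat.of K))) (R : Type u) [CommRing R] [Algebra K R] :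
    Type u :=
  prolongSpec K R ⟶ X

/-- The closed immersion `Spec R ⟶ Spec R[ε]`, as a morphism of `K`-schemes. -/
def prolongIncl (R : Type u) [CommRing R] [Algebra K R] : specOver K R ⟶ prolongSpec K R :=
  Over.homMk (Spec.map (CommRingCat.ofHom (TrivSqZeroExt.fstHom R R R).toRingHom)) (by
    simp only [Over.mk_left, Over.mk_hom, ← Spec.map_comp, ← CommRingCat.ofHom_comp]
    congr 2
    ext c
    simp [twist])

/-- The projection `π : τ(X) → X` on `R`-points. -/
def tauProj {X : Over (Spec (CommRingCat.of K))} {R : Type u} [CommRing R] [Algebra K R]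
    (t : TauPoint X R) : specOver K R ⟶ X :=
  prolongIncl R ≫ t

/-- The homomorphism `R[ε] → R'[ε]` induced by `φ : R → R'`. -/
def dualMap {R R' : Type u} [CommRing R] [CommRing R'] (φ : R →+* R') :
    DualNumber R →+* DualNumber R' where
  toFun z := TrivSqZeroExt.inl (φ z.fst) + TrivSqZeroExt.inr (φ z.snd)
  map_one' := by ext <;> simp
  map_zero' := by ext <;> simp
  map_add' a b := by ext <;> simp
  map_mul' a b := by ext <;> simp [mul_comm]

/-- `Spec R'[ε] ⟶ Spec R[ε]` for a homomorphism `R → R'` of `K`-algebras; composition with it is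
the map `τ(X)(R) → τ(X)(R')`. -/
def prolongMap {R R' : Type u} [CommRing R] [Algebra K R] [CommRing R'] [Algebra K R']
    (φ : R →ₐ[K] R') : prolongSpec K R' ⟶ prolongSpec K R :=
  Over.homMk (Spec.map (CommRingCat.ofHom (dualMap φ.toRingHom))) (by
    simp only [Over.mk_left, Over.mk_hom, ← Spec.map_comp, ← CommRingCat.ofHom_comp]
    congr 2
    ext c <;> simp [twist, dualMap])

/-- The homomorphism `R → R[ε]`, `r ↦ r + δ(r) ε`, for a differential ring `R`. -/
def expDeriv (R : Type u) [CommRing R] [Differential R] : R →+* DualNumber R where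
  toFun r := TrivSqZeroExt.inl r + TrivSqZeroExt.inr r′
  map_one' := by ext <;> simp
  map_zero' := by ext <;> simp
  map_add' a b := by ext <;> simp
  map_mul' a b := by ext <;> simp [mul_comm]

/-- The morphism of `K`-schemes `Spec R[ε] ⟶ Spec R` given by `r ↦ r + δ(r) ε`. -/
def nablaSpec (R : Type u) [CommRing R] [Algebra K R] [Differential R] [DifferentialAlgebra K R] :
    prolongSpec K R ⟶ specOver K R :=
  Over.homMk (Spec.map (CommRingCat.ofHom (expDeriv R))) (by
    simp only [Over.mk_left, Over.mk_hom, ← Spec.map_comp, ← CommRingCat.ofHom_comp]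
    congr 2
    ext c <;> simp [twist, expDeriv, deriv_algebraMap])

/-- The map `∇ : X(R) → τ(X)(R)`, `a ↦ a + δ(a) ε` (in coordinates: `a ↦ (a, δ(a))`), for a
differential `K`-algebra `R`. -/
def nabla {X : Over (Spec (CommRingCat.of K))} {R : Type u} [CommRing R] [Algebra K R]
    [Differential R] [DifferentialAlgebra K R] (a : specOver K R ⟶ X) : TauPoint X R :=
  nablaSpec R ≫ a

end Prolongation

/-! ## D-varieties, D-groups, D-torsors, sharp points -/

section DVarieties

variable {K : Type u} [Field K] [Differential K]

/-- A D-variety structure on `X`: a morphism `s : X ⟶ τ(X)` over `K` which is a section of the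
projection `π`. By Yoneda, a morphism is a family of maps on `R`-points that is natural in the
`K`-algebra `R`. -/
structure DStructure (X : Over (Spec (CommRingCat.of K))) where
  /-- The map `X(R) → τ(X)(R)`. -/
  sec : ∀ {R : Type u} [CommRing R] [Algebra K R], (specOver K R ⟶ X) → TauPoint X R
  natural : ∀ {R R' : Type u} [CommRing R] [Algebra K R] [CommRing R'] [Algebra K R']
    (φ : R →ₐ[K] R') (x : specOver K R ⟶ X), sec (specMap φ ≫ x) = prolongMap φ ≫ sec x
  proj_sec : ∀ {R : Type u} [CommRing R] [Algebra K R] (x : specOver K R ⟶ X),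
    tauProj (sec x) = x

/-- `(G, s)` is an algebraic D-group over `K`: `G` is an algebraic group over `K` and the section
`s : G ⟶ τ(G)` is a homomorphism. -/
structure IsDGroup {G : Over (Spec (CommRingCat.of K))} [GrpObj G] (s : DStructure G) : Prop where
  isVariety : IsVariety G
  sec_mul : ∀ {R : Type u} [CommRing R] [Algebra K R] (g h : specOver K R ⟶ G),
    s.sec (g * h) = s.sec g * s.sec h

/-- A variety `X` over `K` with an action of `G` is an algebraic torsor (a principal homogeneous
space) for `G` if it is non-empty and the action is strictly transitive. As usual in algebraic
geometry the latter is meant on `T`-points for all `T`: equivalently, the morphism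
`(g, x) ↦ (g • x, x)` from `G × X` to `X × X` is an isomorphism. -/
structure IsAlgTorsor (G X : Over (Spec (CommRingCat.of K))) [GrpObj G] [ModObj G X] : Prop where
  isVariety : IsVariety X
  nonempty : Nonempty X.left
  existsUnique_smul_eq : ∀ (T : Over (Spec (CommRingCat.of K))) (x y : T ⟶ X),
    ∃! g : T ⟶ G, g • x = y

/-- `(X, s)` is a D-torsor for `(G, sG)`: `X` is an algebraic torsor for `G` and
`s(g • x) = sG(g) • s(x)`. -/
structure IsDTorsor {G X : Over (Spec (CommRingCat.of K))} [GrpObj G] [ModObj G X]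
    (sG : DStructure G) (s : DStructure X) : Prop where
  isAlgTorsor : IsAlgTorsor G X
  sec_smul : ∀ {R : Type u} [CommRing R] [Algebra K R] (g : specOver K R ⟶ G)
    (x : specOver K R ⟶ X), s.sec (g • x) = sG.sec g • s.sec x

variable (U : Type u) [Field U] [Differential U] [Algebra K U] [DifferentialAlgebra K U]

/-- The set `(X, s)^♯` of sharp points: the `a ∈ X(U)` with `s(a) = ∇(a)`. -/
def sharp {X : Over (Spec (CommRingCat.of K))} (s : DStructure X) : Set (specOver K U ⟶ X) :=
  {a | s.sec a = nabla a}

variable {U}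

/-- The action of `G^♯` on `X^♯`, the restriction of the action of `G(U)` on `X(U)`. -/
def IsDTorsor.sharpSMul {G X : Over (Spec (CommRingCat.of K))} [GrpObj G] [ModObj G X]
    {sG : DStructure G} {s : DStructure X} (h : IsDTorsor sG s) (g : sharp U sG) (x : sharp U s) :
    sharp U s :=
  ⟨g.1 • x.1, by
    have hg : sG.sec g.1 = nabla g.1 := g.2
    have hx : s.sec x.1 = nabla x.1 := x.2
    change s.sec (g.1 • x.1) = nabla (g.1 • x.1)
    rw [h.sec_smul, hg, hx, nabla, nabla, nabla, ModObj.comp_smul]⟩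

/-- A map `g : S → T` between sets of `U`-points of `X` and `Y` is a differential morphism over `K`
if it is continuous for the Kolchin topology over `K` and pulls back regular functions to functions
that are locally, for the Kolchin topology over `K`, quotients of differential polynomials
over `K`: for every `a ∈ S` and every regular function `h` on an affine open `V ⊆ Y` around `g a`,
there are regular functions `u₁, …, uₙ` on an affine open `W ⊆ X` around `a`, and differential
polynomials `P`, `Q` over `K`, such that `Q(u(a)) ≠ 0`, and `g b ∈ V` and
`h(g b) = P(u(b)) / Q(u(b))` for all `b ∈ S ∩ W` with `Q(u(b)) ≠ 0`. -/
def IsDifferentialMorphism {X Y : Over (Spec (CommRingCat.of K))} {S : Set (specOver K U ⟶ X)}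
    {T : Set (specOver K U ⟶ Y)} (g : S → T) : Prop :=
  ∀ (a : S) (V : Y.left.Opens), IsAffineOpen V → LiesIn (g a).1 V → ∀ h : Γ(Y.left, V),
    ∃ W : X.left.Opens, IsAffineOpen W ∧ ∃ (ha : LiesIn a.1 W) (n : ℕ) (u : Fin n → Γ(X.left, W))
      (P Q : MvPolynomial (Fin n × ℕ) K),
      diffEval (fun i => valueAt a.1 W ha (u i)) Q ≠ 0 ∧
      ∀ (b : S) (hb : LiesIn b.1 W), diffEval (fun i => valueAt b.1 W hb (u i)) Q ≠ 0 →
        ∃ hV : LiesIn (g b).1 V,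
          valueAt (g b).1 V hV h =
            diffEval (fun i => valueAt b.1 W hb (u i)) P /
              diffEval (fun i => valueAt b.1 W hb (u i)) Q

end DVarieties

end DiffAlg

end

/-! The given `f` need not respect the sections, so it is replaced by another equivariant morphism.
Choose a finite Galois extension L of K and a point x in X(L); the derivation extends to L. Two
invariants describe x: the cocycle g_σ with g_σ·x = σ(x), and the element h of τ(G)(L) with h·s_X(x)
= ∇(x). If y in Y(L) has the same two invariants, then g·x ↦ g·y is well defined over K, because the
cocycles agree (`exists_hom_of_same_cocycle`), and it preserves sharp points, because g·x is sharp
exactly when s_G(g) = ∇(g)·h, a condition that does not mention x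
(`smul_mem_sharp_of_same_logDeriv`). Exchanging x and y gives the inverse.

To find y (`IsDifferentiallyLarge.exists_same_cocycle`), twist the Galois action on Y × Spec L by
g_σ and its D-structure by h. The required y are the equivariant sharp points, and f(x) is an
equivariant point. On a Galois-stable affine neighbourhood of f(x), the invariant functions form a
finitely generated differential K-algebra with a K-point. Such an algebra has a differential K-point
(`IsDifferentiallyLarge.exists_differential_algHom`), and Galois descent turns it into y.

That last existence result is where differential largeness enters. Taylor expansion at a K-point is
a differential homomorphism into K[[t]] with d/dt, where K itself is embedded by Taylor series. A
large field of characteristic zero is existentially closed in K((t)) for this embedding too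
(`IsLarge.isFieldEC`), hence existentially closed as a differential field, and the point in K((t))
can be brought down to K. -/

noncomputable section

namespace DiffAlg

/-! ### Affine K-schemes and K-algebra homomorphisms -/

section Affine

variable {K : Type u} [Field K]
variable {R S T : Type u} [CommRing R] [Algebra K R] [CommRing S] [Algebra K S]
  [CommRing T] [Algebra K T]

lemma specMap_id : specMap (AlgHom.id K R) = 𝟙 (specOver K R) := by
  ext1
  exact Spec.map_id _

lemma specMap_comp (φ : R →ₐ[K] S) (ψ : S →ₐ[K] T) :
    specMap ψ ≫ specMap φ = specMap (ψ.comp φ) := by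
  ext1
  exact (Spec.map_comp _ _).symm

/-- The homomorphism of `K`-algebras attached to a morphism of affine `K`-schemes. -/
def algHomOf (f : specOver K S ⟶ specOver K R) : R →ₐ[K] S where
  __ := (Spec.preimage f.left).hom
  commutes' c := by
    have h : CommRingCat.ofHom (algebraMap K R) ≫ Spec.preimage f.left =
        CommRingCat.ofHom (algebraMap K S) := by
      apply Spec.map_injective
      rw [Spec.map_comp, Spec.map_preimage]
      exact Over.w f
    exact congr($h c)

@[simp]
lemma specMap_algHomOf (f : specOver K S ⟶ specOver K R) : specMap (algHomOf f) = f := by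
  ext1
  exact Spec.map_preimage _

lemma specMap_injective {φ ψ : R →ₐ[K] S} (h : specMap φ = specMap ψ) : φ = ψ := by
  have h' : Spec.map (CommRingCat.ofHom φ.toRingHom) =
    Spec.map (CommRingCat.ofHom ψ.toRingHom) := congr(($h).left)
  have := Spec.map_injective h'
  ext x
  exact congr($this x)

lemma isVariety_specOver [IsDomain R] [Algebra.FiniteType K R] : IsVariety (specOver K R) where
  isReduced := by dsimp; infer_instance
  locallyOfFiniteType := by
    dsimp
    rw [HasRingHomProperty.Spec_iff (P := @LocallyOfFiniteType)]
    simpa [RingHom.finiteType_algebraMap]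
  quasiCompact := by dsimp; infer_instance
  isSeparated := by dsimp; infer_instance

end Affine

/-! ### Smooth loci of hypersurfaces -/

section Smooth

variable {K : Type u} [Field K] {σ : Type} [Finite σ]

/-- The hypersurface algebra of a polynomial. -/
abbrev Hypersurface (H : MvPolynomial σ K) : Type u :=
  MvPolynomial σ K ⧸ Ideal.span (Set.range fun _ : Unit => H)

/-- The one-equation presentation has Jacobian ∂H/∂xᵢ, which inverting makes a unit: the Jacobian
criterion. -/
lemma isStandardSmooth_hypersurface (H : MvPolynomial σ K) (i : σ) :
    Algebra.IsStandardSmooth K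
      (Localization.Away (Ideal.Quotient.mk _ (H.pderiv i) : Hypersurface H)) := by
  classical
  let r : Hypersurface H := Ideal.Quotient.mk _ (H.pderiv i)
  let P := Algebra.PreSubmersivePresentation.naive (v := fun _ : Unit => H) (fun _ => i)
    (fun _ _ _ => rfl)
  have hP : P.jacobian = r := by
    rw [Algebra.PreSubmersivePresentation.jacobian_eq_jacobiMatrix_det]
    have : P.jacobiMatrix () () = H.pderiv i :=
      Algebra.PreSubmersivePresentation.jacobiMatrix_naive _ _ _ _ _ _
    rw [Matrix.det_unique]
    exact congrArg _ this
  let Q := Algebra.PreSubmersivePresentation.localizationAway (Localization.Away r) r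
  let PQ : Algebra.SubmersivePresentation K (Localization.Away r) _ _ :=
    { Q.comp P with
      jacobian_isUnit := by
        change IsUnit (Q.comp P).jacobian
        rw [Algebra.PreSubmersivePresentation.comp_jacobian_eq_jacobian_smul_jacobian, hP,
          Algebra.PreSubmersivePresentation.localizationAway_jacobian, Algebra.smul_def]
        have := IsLocalization.Away.algebraMap_isUnit (S := Localization.Away r) r
        exact this.mul this }
  exact PQ.isStandardSmooth

end Smooth

/-! ### Rational points of hypersurfaces over large fields -/

section Large

variable {K : Type u} [Field K] {σ : Type} [Finite σ]

/-- The basic open subscheme `D(r)` of `Spec R`. -/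
def specBasicOpen {R : Type u} [CommRing R] (r : R) : (Spec (CommRingCat.of R)).Opens :=
  PrimeSpectrum.basicOpen r

lemma location_specMap {R : Type u} [CommRing R] [Algebra K R] (φ : R →ₐ[K] K) (r : R) :
    location (specMap φ) ∈ specBasicOpen r ↔ φ r ≠ 0 := by
  change r ∉ Ideal.comap φ.toRingHom (IsLocalRing.maximalIdeal K) ↔ _
  rw [Ideal.mem_comap, IsLocalRing.mem_maximalIdeal, mem_nonunits_iff, isUnit_iff_ne_zero,
    not_not]
  rfl

lemma smooth_basicOpen {R : Type u} [CommRing R] [Algebra K R] (r : R)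
    [Algebra.IsStandardSmooth K (Localization.Away r)] :
    Smooth ((specBasicOpen r).ι ≫ (specOver K R).hom) := by
  have : IsOpenImmersion (Spec.map (CommRingCat.ofHom (algebraMap R (Localization.Away r)))) :=
    IsOpenImmersion.of_isLocalization r
  let e := IsOpenImmersion.isoOfRangeEq
    (Spec.map (CommRingCat.ofHom (algebraMap R (Localization.Away r))))
    (specBasicOpen r).ι (by
      rw [Scheme.Opens.range_ι]
      exact PrimeSpectrum.localization_away_comap_range _ r)
  have h : (specBasicOpen r).ι =
      e.inv ≫ Spec.map (CommRingCat.ofHom (algebraMap R (Localization.Away r))) := by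
    simp [e]
  rw [h, Category.assoc]
  have : Smooth (Spec.map (CommRingCat.ofHom (algebraMap R (Localization.Away r))) ≫
      (specOver K R).hom) := by
    dsimp
    rw [← Spec.map_comp, ← CommRingCat.ofHom_comp, ← IsScalarTower.algebraMap_eq,
      HasRingHomProperty.Spec_iff (P := @Smooth)]
    rw [CommRingCat.hom_ofHom, RingHom.smooth_algebraMap]
    infer_instance
  infer_instance

/-- A hypersurface over a large field has points outside a given hypersurface, provided it has
a smooth rational point none of whose branches lies on the latter. -/
theorem IsLarge.exists_zero (hK : IsLarge K) (H g : MvPolynomial σ K) (p : σ → K) (i : σ)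
    (hp : MvPolynomial.eval p H = 0) (hi : MvPolynomial.eval p (H.pderiv i) ≠ 0)
    (hg : ∀ H₁, Prime H₁ → H₁ ∣ H → MvPolynomial.eval p H₁ = 0 → ¬ H₁ ∣ g) :
    ∃ x : σ → K, MvPolynomial.eval x H = 0 ∧ MvPolynomial.eval x g ≠ 0 := by
  classical
  have hH : H ≠ 0 := by rintro rfl; simp at hi
  -- Largeness concerns irreducible varieties, so H is replaced by a prime factor through p. By the
  -- Leibniz rule p remains a smooth point of it.
  obtain ⟨H₁, hH₁, hdvd, hp₁⟩ : ∃ H₁, Prime H₁ ∧ H₁ ∣ H ∧ MvPolynomial.eval p H₁ = 0 := by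
    obtain ⟨s, hs, u, hu⟩ := UniqueFactorizationMonoid.exists_prime_factors H hH
    have h0 : MvPolynomial.eval p s.prod = 0 := by
      have h1 : MvPolynomial.eval p (s.prod * (u : MvPolynomial σ K)) = 0 := by rw [hu, hp]
      rw [map_mul] at h1
      exact (mul_eq_zero.1 h1).resolve_right ((u.isUnit.map (MvPolynomial.eval p)).ne_zero)
    rw [map_multiset_prod, Multiset.prod_eq_zero_iff, Multiset.mem_map] at h0
    obtain ⟨q, hq, hq0⟩ := h0
    exact ⟨q, hs q hq, (Multiset.dvd_prod hq).trans ⟨u, hu.symm⟩, hq0⟩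
  have hi₁ : MvPolynomial.eval p (H₁.pderiv i) ≠ 0 := by
    obtain ⟨B, rfl⟩ := hdvd
    intro h0
    apply hi
    simp [Derivation.leibniz, hp₁, h0]
  let R := Hypersurface H₁
  have hspan : Ideal.span (Set.range fun _ : Unit => H₁) = Ideal.span {H₁} := by simp
  have hprime : (Ideal.span (Set.range fun _ : Unit => H₁)).IsPrime := by
    rw [hspan, Ideal.span_singleton_prime hH₁.ne_zero]
    exact hH₁
  let φ : R →ₐ[K] K := Ideal.Quotient.liftₐ _ (MvPolynomial.aeval p) (by
    intro a ha
    rw [hspan, Ideal.mem_span_singleton] at ha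
    obtain ⟨b, rfl⟩ := ha
    simp [MvPolynomial.aeval_eq_eval, hp₁])
  let r : R := Ideal.Quotient.mk _ (H₁.pderiv i)
  have hstd : Algebra.IsStandardSmooth K (Localization.Away r) :=
    isStandardSmooth_hypersurface H₁ i
  have hi₁' : φ r ≠ 0 := by
    change MvPolynomial.aeval p (H₁.pderiv i) ≠ 0
    rwa [MvPolynomial.aeval_eq_eval]
  have hdense := hK (specOver K R) isVariety_specOver
    (inferInstanceAs (IrreducibleSpace (PrimeSpectrum R)))
    ⟨specMap φ, specBasicOpen r, (location_specMap φ r).2 hi₁', smooth_basicOpen r⟩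
  have hgr : (Ideal.Quotient.mk _ g : R) ≠ 0 := by
    rw [Ne, Ideal.Quotient.eq_zero_iff_mem, hspan, Ideal.mem_span_singleton]
    exact hg H₁ hH₁ hdvd hp₁
  have hne : (specBasicOpen (Ideal.Quotient.mk _ g : R) :
      Set (Spec (CommRingCat.of R))).Nonempty := by
    refine ⟨⟨⊥, Ideal.isPrime_bot⟩, ?_⟩
    simpa [PrimeSpectrum.mem_basicOpen] using! hgr
  obtain ⟨_, hxU, b, rfl⟩ := hdense.inter_open_nonempty _
    (specBasicOpen (Ideal.Quotient.mk _ g : R)).2 hne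
  rw [← specMap_algHomOf b] at hxU
  replace hxU := (location_specMap _ _).1 hxU
  let q : MvPolynomial σ K →ₐ[K] R := Ideal.Quotient.mkₐ K _
  have hval : ∀ P : MvPolynomial σ K,
      MvPolynomial.aeval (fun j => algHomOf b (q (MvPolynomial.X j))) P = algHomOf b (q P) := by
    intro P
    have : MvPolynomial.aeval (fun j => algHomOf b (q (MvPolynomial.X j))) =
        (algHomOf b).comp q := by
      ext j; simp
    rw [this]; rfl
  simp only [← MvPolynomial.coe_aeval_eq_eval, RingHom.coe_coe]
  refine ⟨fun j => algHomOf b (q (MvPolynomial.X j)), ?_, ?_⟩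
  · rw [hval]
    have : q H = 0 := by
      refine Ideal.Quotient.eq_zero_iff_mem.2 ?_
      rw [hspan, Ideal.mem_span_singleton]
      exact hdvd
    rw [this, map_zero]
  · rw [hval]; exact hxU

end Large

/-! ### From arcs to rational points: approximation in a discrete valuation ring -/

section Approximation

open Polynomial in
/-- In a discrete valuation ring with residue field `K`, polynomials in the uniformizer are
dense. -/
lemma exists_pow_dvd_sub_aeval {K V : Type*} [Field K] [CommRing V] [Algebra K V] {t : V}
    (hV : ∀ v : V, ∃ c : K, t ∣ v - algebraMap K V c) (N : ℕ) (v : V) :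
    ∃ p : K[X], t ^ N ∣ v - aeval t p := by
  induction N generalizing v with
  | zero => exact ⟨0, by simp⟩
  | succ N ih =>
    obtain ⟨c, w, hw⟩ := hV v
    obtain ⟨p, q, hq⟩ := ih w
    refine ⟨C c + X * p, q, ?_⟩
    simp only [map_add, aeval_C, map_mul, aeval_X]
    linear_combination hw + t * hq

open Polynomial in
-- Nonzero constants of K are units of V, so the t-adic order of p(t) is the order of p at 0.
lemma X_pow_dvd_of_pow_dvd_aeval {K V : Type*} [Field K] [CommRing V] [IsDomain V] [Algebra K V]
    {t : V} (ht : Irreducible t) (n : ℕ) (p : K[X]) (h : t ^ n ∣ aeval t p) : X ^ n ∣ p := by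
  induction n with
  | zero => simp
  | succ n ih =>
    obtain ⟨q, rfl⟩ := ih ((pow_dvd_pow t n.le_succ).trans h)
    rw [pow_succ]
    refine mul_dvd_mul_left _ ?_
    rw [X_dvd_iff]
    by_contra hc
    rw [map_mul, map_pow, aeval_X, pow_succ] at h
    have h' := (mul_dvd_mul_iff_left (pow_ne_zero n ht.ne_zero)).1 h
    rw [← divX_mul_X_add q, map_add, map_mul, aeval_X, aeval_C,
      dvd_add_right (Dvd.intro_left _ rfl)] at h'
    exact ht.not_isUnit (isUnit_of_dvd_unit h' ((IsUnit.mk0 _ hc).map _))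

open Polynomial in
/-- An element of order `n` of a discrete valuation ring is congruent modulo a higher power of the
uniformizer only to polynomials of order `n` in the uniformizer. -/
lemma exists_eq_X_pow_mul {K V : Type*} [Field K] [CommRing V] [IsDomain V] [Algebra K V]
    {t : V} (ht : Irreducible t) {n N : ℕ} (hn : n < N) (p : K[X]) {v u : V} (hu : IsUnit u)
    (hv : v = u * t ^ n) (h : t ^ N ∣ v - aeval t p) :
    ∃ q : K[X], p = X ^ n * q ∧ q.coeff 0 ≠ 0 := by
  have h1 : t ^ n ∣ aeval t p := by
    have := (pow_dvd_pow t hn.le).trans h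
    rwa [dvd_sub_right (hv ▸ Dvd.intro_left _ rfl)] at this
  obtain ⟨q, rfl⟩ := X_pow_dvd_of_pow_dvd_aeval ht n p h1
  refine ⟨q, rfl, fun h0 => ?_⟩
  obtain ⟨r, rfl⟩ := X_dvd_iff.2 h0
  have h2 := (pow_dvd_pow t hn).trans h
  rw [Nat.succ_eq_add_one, dvd_sub_left] at h2
  · rw [hv, pow_succ, mul_comm u, mul_dvd_mul_iff_left (pow_ne_zero n ht.ne_zero)] at h2
    exact ht.not_isUnit (isUnit_of_dvd_unit h2 hu)
  · simp only [map_mul, map_pow, aeval_X]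
    exact ⟨aeval t r, by ring⟩

/-- The first-order Taylor expansion of a polynomial in one of its variables. -/
lemma exists_aeval_add_single {K A τ : Type*} [Field K] [CommRing A] [Algebra K A]
    [DecidableEq τ] (a : τ → A) (i : τ) (s : A) (f : MvPolynomial τ K) :
    ∃ k, MvPolynomial.aeval (a + Pi.single i s) f =
      MvPolynomial.aeval a f + MvPolynomial.aeval a (f.pderiv i) * s + s ^ 2 * k := by
  induction f using MvPolynomial.induction_on with
  | C c => exact ⟨0, by simp⟩
  | add p q hp hq =>
    obtain ⟨k, hk⟩ := hp
    obtain ⟨l, hl⟩ := hq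
    exact ⟨k + l, by simp only [map_add, hk, hl]; ring⟩
  | mul_X p j hp =>
    obtain ⟨k, hk⟩ := hp
    by_cases hj : j = i
    · subst hj
      refine ⟨k * (a j + s) + MvPolynomial.aeval a (p.pderiv j), ?_⟩
      simp only [map_mul, hk, MvPolynomial.aeval_X, Pi.add_apply, Pi.single_eq_same,
        Derivation.leibniz, MvPolynomial.pderiv_X_self, smul_eq_mul, map_add, map_one]
      ring
    · refine ⟨k * a j, ?_⟩
      simp only [map_mul, hk, MvPolynomial.aeval_X, Pi.add_apply, Pi.single_eq_of_ne hj,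
        Derivation.leibniz, MvPolynomial.pderiv_X_of_ne hj, smul_eq_mul, map_add, map_zero]
      ring

lemma dvd_aeval_sub_aeval {K A τ : Type*} [Field K] [CommRing A] [Algebra K A]
    {a b : τ → A} {s : A} (h : ∀ j, s ∣ a j - b j) (f : MvPolynomial τ K) :
    s ∣ MvPolynomial.aeval a f - MvPolynomial.aeval b f := by
  induction f using MvPolynomial.induction_on with
  | C c => simp
  | add p q hp hq =>
    simp only [map_add]
    convert dvd_add hp hq using 1
    ring
  | mul_X p j hp =>
    obtain ⟨k, hk⟩ := hp
    obtain ⟨l, hl⟩ := h j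
    refine ⟨k * a j + MvPolynomial.aeval b p * l, ?_⟩
    simp only [map_mul, MvPolynomial.aeval_X]
    linear_combination a j * hk + MvPolynomial.aeval b p * hl

/-- A polynomial equation over a large field `K` that has a simple solution in a discrete valuation
ring with residue field `K` has a solution in `K`. -/
theorem IsLarge.exists_zero_of_dvr {K : Type u} [Field K] (hK : IsLarge K) {V : Type*} [CommRing V]
    [IsDomain V] [IsDiscreteValuationRing V] [Algebra K V] {t : V} (ht : Irreducible t)
    (hV : ∀ v : V, ∃ c : K, t ∣ v - algebraMap K V c) {τ : Type*}
    (f g : MvPolynomial τ K) (z : τ → V) (i : τ) (hf : MvPolynomial.aeval z f = 0)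
    (hi : MvPolynomial.aeval z (f.pderiv i) ≠ 0) (hg : MvPolynomial.aeval z g ≠ 0) :
    ∃ x : τ → K, MvPolynomial.aeval x f = 0 ∧ MvPolynomial.aeval x g ≠ 0 := by
  classical
  obtain ⟨e, u, hu⟩ := IsDiscreteValuationRing.eq_unit_mul_pow_irreducible hi ht
  obtain ⟨k, v, hv⟩ := IsDiscreteValuationRing.eq_unit_mul_pow_irreducible hg ht
  -- A Newton-type change of variable. Here e and k are the orders of ∂f/∂xᵢ and g at z. The arc z
  -- is truncated modulo t^N, and its i-th coordinate is then perturbed by T^M Y. The choice M > e +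
  -- k makes the quadratic Taylor term negligible beside the linear one and leaves the order of g
  -- unchanged; N > M + e does the same for the truncation error in f.
  let M := e + k + 1
  let N := M + e + 1
  choose p hp using fun j => exists_pow_dvd_sub_aeval hV N (z j)
  have hcomp : ∀ P : MvPolynomial τ K,
      Polynomial.aeval t (MvPolynomial.aeval p P) =
        MvPolynomial.aeval (fun j => Polynomial.aeval t (p j)) P := by
    intro P
    rw [← AlgHom.comp_apply]
    congr 1
    ext j; simp
  have hdvd : ∀ P : MvPolynomial τ K,
      t ^ N ∣ MvPolynomial.aeval z P - Polynomial.aeval t (MvPolynomial.aeval p P) := by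
    intro P
    rw [hcomp]
    exact dvd_aeval_sub_aeval hp P
  obtain ⟨h, hh⟩ : Polynomial.X ^ N ∣ MvPolynomial.aeval p f := by
    refine X_pow_dvd_of_pow_dvd_aeval ht N _ ?_
    have := hdvd f
    rwa [hf, zero_sub, dvd_neg] at this
  obtain ⟨w, hw, hw0⟩ := exists_eq_X_pow_mul ht (show e < N by omega) _ u.isUnit hu
    (hdvd (f.pderiv i))
  obtain ⟨g₀, hg₀, hg0⟩ := exists_eq_X_pow_mul ht (show k < N by omega) _ v.isUnit hv
    (hdvd g)
  let T : MvPolynomial (Fin 2) K := MvPolynomial.X 0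
  let Y : MvPolynomial (Fin 2) K := MvPolynomial.X 1
  let inc : Polynomial K →ₐ[K] MvPolynomial (Fin 2) K := Polynomial.aeval T
  have hinc : ∀ P : MvPolynomial τ K, MvPolynomial.aeval (fun j => inc (p j)) P =
      inc (MvPolynomial.aeval p P) := by
    intro P
    rw [← AlgHom.comp_apply]
    congr 1
    ext j; simp
  let P : τ → MvPolynomial (Fin 2) K := (fun j => inc (p j)) + Pi.single i (T ^ M * Y)
  obtain ⟨k₁, hk₁⟩ := exists_aeval_add_single (fun j => inc (p j)) i (T ^ M * Y) f
  obtain ⟨k₂, hk₂⟩ := exists_aeval_add_single (fun j => inc (p j)) i (T ^ M * Y) g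
  have hincX : inc Polynomial.X = T := by simp [inc]
  -- After division by T^(M+e), f becomes a plane curve through the origin, where its Y-derivative
  -- is w(0) ≠ 0.
  let H : MvPolynomial (Fin 2) K := T * inc h + inc w * Y + T * (T ^ k * Y ^ 2 * k₁)
  have hH : MvPolynomial.aeval P f = T ^ (M + e) * H := by
    rw [hk₁, hinc, hinc, hh, hw]
    simp only [map_mul, map_pow, hincX, H, N, M]
    ring
  let G : MvPolynomial (Fin 2) K := inc g₀ + T * (T ^ e * Y * (MvPolynomial.aeval
    (fun j => inc (p j)) (g.pderiv i) + T ^ M * Y * k₂))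
  have hG : MvPolynomial.aeval P g = T ^ k * G := by
    rw [hk₂, hinc, hg₀]
    simp only [map_mul, map_pow, hincX, G, M]
    ring
  have hT : MvPolynomial.eval 0 T = 0 := by simp [T]
  have hY : MvPolynomial.eval 0 Y = 0 := by simp [Y]
  have hev : ∀ q : Polynomial K, MvPolynomial.eval 0 (inc q) = q.coeff 0 := by
    intro q
    have : MvPolynomial.aeval (0 : Fin 2 → K) (inc q) = Polynomial.aeval 0 q := by
      rw [← AlgHom.comp_apply]
      congr 1
      ext; simp [inc, T]
    rw [MvPolynomial.aeval_eq_eval] at this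
    refine this.trans ?_
    simp [Polynomial.coeff_zero_eq_aeval_zero]
  have hG0 : MvPolynomial.eval 0 G ≠ 0 := by
    simp only [G, map_add, map_mul, hT, hev]
    simpa using hg0
  have hTY : T.pderiv 1 = 0 := MvPolynomial.pderiv_X_of_ne (by decide)
  have hYY : Y.pderiv 1 = 1 := MvPolynomial.pderiv_X_self _
  have hHY : MvPolynomial.eval 0 (H.pderiv 1) ≠ 0 := by
    simp only [H, map_add, Derivation.leibniz, smul_eq_mul, hTY, hYY, map_mul, hT, hY, hev]
    simpa using hw0
  obtain ⟨x, hx, hx'⟩ := hK.exists_zero H (T * G) 0 1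
    (by simp only [H, map_add, map_mul, hT, hY]; simp) hHY (by
      intro H₁ hH₁ hH₁d hz hd
      -- The branch of the curve through the origin is not the line T = 0, since its Y-derivative
      -- there is nonzero, and it does not lie in G = 0, since G(0) ≠ 0.
      rcases hH₁.dvd_or_dvd hd with hd | ⟨B, hB⟩
      · obtain ⟨B, hB⟩ := hd
        obtain ⟨D, hD⟩ := hH₁d
        have h1 : MvPolynomial.eval 0 (H₁.pderiv 1) ≠ 0 := by
          intro h0
          apply hHY
          rw [hD]
          simp only [Derivation.leibniz, smul_eq_mul, map_add, map_mul, hz, h0]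
          simp
        have hB1 : IsUnit B :=
          ((MvPolynomial.X_prime (R := K) (i := (0 : Fin 2))).irreducible.isUnit_or_isUnit
          hB).resolve_left hH₁.not_isUnit
        have h2 := congrArg (fun q => MvPolynomial.eval 0 (MvPolynomial.pderiv 1 q)) hB
        simp only [hTY, Derivation.leibniz, smul_eq_mul, map_add, map_mul, hz, map_zero, zero_mul,
          zero_add] at h2
        exact mul_ne_zero (hB1.map (MvPolynomial.eval 0)).ne_zero h1 h2.symm
      · apply hG0
        rw [hB, map_mul, hz, zero_mul])
  have hval : ∀ Q : MvPolynomial τ K, MvPolynomial.aeval (fun j => MvPolynomial.eval x (P j)) Q =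
      MvPolynomial.eval x (MvPolynomial.aeval P Q) := by
    intro Q
    have : MvPolynomial.aeval (fun j => MvPolynomial.eval x (P j)) =
        (MvPolynomial.aeval x).comp (MvPolynomial.aeval (R := K) P) := by
      ext j; simp [MvPolynomial.aeval_eq_eval]
    rw [this, AlgHom.comp_apply, MvPolynomial.aeval_eq_eval]
  rw [map_mul] at hx'
  refine ⟨fun j => MvPolynomial.eval x (P j), ?_, ?_⟩
  · rw [hval, hH, map_mul, hx, mul_zero]
  · rw [hval, hG, map_mul, map_pow]
    exact mul_ne_zero (pow_ne_zero _ (left_ne_zero_of_mul hx')) (right_ne_zero_of_mul hx')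

end Approximation

/-! ### Large fields are existentially closed in fraction fields of discrete valuation rings -/

section FieldEC

/-- Homogenization: a polynomial in fractions `v / t ^ r` is, up to a power of `t`, a polynomial in
the numerators and `t`, compatibly with partial derivatives. -/
lemma exists_homogenization {K τ : Type*} [Field K] (r : ℕ) (i : τ) (f : MvPolynomial τ K) :
    ∃ (s : ℕ) (f' : MvPolynomial (Option τ) K), ∀ {F : Type u} [Field F] [Algebra K F]
      (v : Option τ → F) (w : τ → F), (∀ j, v (some j) = w j * v none ^ r) →
      MvPolynomial.aeval v f' = v none ^ s * MvPolynomial.aeval w f ∧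
      MvPolynomial.aeval v (f'.pderiv (some i)) * v none ^ r =
        v none ^ s * MvPolynomial.aeval w (f.pderiv i) := by
  classical
  induction f using MvPolynomial.induction_on with
  | C c => exact ⟨0, MvPolynomial.C c, fun v w _ => by simp⟩
  | add p q hp hq =>
    obtain ⟨s, p', hp⟩ := hp
    obtain ⟨s', q', hq⟩ := hq
    refine ⟨s + s', MvPolynomial.X none ^ s' * p' + MvPolynomial.X none ^ s * q',
      fun v w h => ?_⟩
    obtain ⟨h1, h2⟩ := hp v w h
    obtain ⟨h3, h4⟩ := hq v w h
    have hX : (MvPolynomial.X none : MvPolynomial (Option τ) K).pderiv (some i) = 0 :=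
      MvPolynomial.pderiv_X_of_ne (by simp)
    simp only [map_add, map_mul, map_pow, MvPolynomial.aeval_X, h1, h3, Derivation.leibniz,
      Derivation.leibniz_pow, hX, smul_zero, smul_eq_mul, add_zero, mul_zero]
    constructor
    · ring
    · linear_combination v none ^ s' * h2 + v none ^ s * h4
  | mul_X p j hp =>
    obtain ⟨s, p', hp⟩ := hp
    refine ⟨s + r, p' * MvPolynomial.X (some j), fun v w h => ?_⟩
    obtain ⟨h1, h2⟩ := hp v w h
    by_cases hj : j = i
    · subst hj
      simp only [map_mul, map_add, MvPolynomial.aeval_X, h1, h, Derivation.leibniz,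
        MvPolynomial.pderiv_X_self, smul_eq_mul, mul_one]
      constructor
      · ring
      · linear_combination w j * v none ^ r * h2
    · have hj' : (some j : Option τ) ≠ some i := by simpa using hj
      simp only [map_mul, MvPolynomial.aeval_X, h1, h, Derivation.leibniz,
        MvPolynomial.pderiv_X_of_ne hj, MvPolynomial.pderiv_X_of_ne hj', smul_eq_mul,
        mul_zero, zero_add]
      constructor
      · ring
      · linear_combination w j * v none ^ r * h2

section Fraction

variable {K : Type u} [Field K] {V : Type u} [CommRing V]
  [IsDomain V] [IsDiscreteValuationRing V] [Algebra K V] {t : V}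
  {F : Type u} [Field F] [Algebra K F] [Algebra V F] [IsScalarTower K V F] [IsFractionRing V F]

/-- Every denominator is a unit times a power of t; the sum of the exponents serves for all entries
at once. -/
lemma exists_common_denominator (ht : Irreducible t) {τ : Type*} [Finite τ] (w : τ → F) :
    ∃ (r : ℕ) (v : τ → V), ∀ j, algebraMap V F (v j) = w j * algebraMap V F t ^ r := by
  have h : ∀ j, ∃ (n : ℕ) (v : V), algebraMap V F v = w j * algebraMap V F t ^ n := by
    intro j
    obtain ⟨a, b, hb, hab⟩ := IsFractionRing.div_surjective (A := V) (w j)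
    have hb0 := nonZeroDivisors.ne_zero hb
    obtain ⟨n, c, hc⟩ := IsDiscreteValuationRing.eq_unit_mul_pow_irreducible hb0 ht
    refine ⟨n, a * (c⁻¹ : Vˣ), ?_⟩
    have hbF : algebraMap V F b ≠ 0 := by
      simpa using (FaithfulSMul.algebraMap_injective V F).ne hb0
    have hc' : algebraMap V F c * algebraMap V F (c⁻¹ : Vˣ) = 1 := by
      rw [← map_mul]; simp
    rw [← hab, map_mul, div_mul_eq_mul_div, eq_div_iff hbF, hc, map_mul, map_pow]
    linear_combination algebraMap V F a * algebraMap V F t ^ n * hc'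
  choose n v hv using h
  cases nonempty_fintype τ
  refine ⟨∑ j, n j, fun j => v j * t ^ ((∑ j, n j) - n j), fun j => ?_⟩
  have hle : n j ≤ ∑ j, n j := Finset.single_le_sum (fun _ _ => Nat.zero_le _) (Finset.mem_univ j)
  rw [map_mul, hv, map_pow, mul_assoc, ← pow_add, Nat.add_sub_cancel' hle]

theorem IsLarge.exists_zero_of_fractionField (hK : IsLarge K) (ht : Irreducible t)
    (hV : ∀ v : V, ∃ c : K, t ∣ v - algebraMap K V c) {τ : Type*} [Finite τ]
    (f g : MvPolynomial τ K) (w : τ → F) (i : τ) (hf : MvPolynomial.aeval w f = 0)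
    (hi : MvPolynomial.aeval w (f.pderiv i) ≠ 0) (hg : MvPolynomial.aeval w g ≠ 0) :
    ∃ x : τ → K, MvPolynomial.aeval x f = 0 ∧ MvPolynomial.aeval x g ≠ 0 := by
  obtain ⟨r, v, hv⟩ := exists_common_denominator ht w
  obtain ⟨s, f', hf'⟩ := exists_homogenization.{u} r i f
  obtain ⟨s', g', hg'⟩ := exists_homogenization.{u} r i g
  have hinj := FaithfulSMul.algebraMap_injective V F
  have htF : algebraMap V F t ≠ 0 := by simpa using hinj.ne ht.ne_zero
  let v' : Option τ → V := fun o => o.elim t v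
  have hcomp : ∀ P : MvPolynomial (Option τ) K, algebraMap V F (MvPolynomial.aeval v' P) =
      MvPolynomial.aeval (fun o => algebraMap V F (v' o)) P := fun P =>
    (MvPolynomial.aeval_algebraMap_apply F v' P).symm
  obtain ⟨h1, h2⟩ := hf' (fun o => algebraMap V F (v' o)) w hv
  obtain ⟨h3, -⟩ := hg' (fun o => algebraMap V F (v' o)) w hv
  rw [← hcomp] at h1 h2 h3
  rw [hf, mul_zero] at h1
  -- The factor `X none` keeps the coordinate replacing t nonzero, so that the solution can be
  -- dehomogenized.
  obtain ⟨x, hx, hx'⟩ := hK.exists_zero_of_dvr ht hV f' (g' * MvPolynomial.X none) v' (some i)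
    (hinj (by rw [h1, map_zero]))
    (by
      intro h0
      rw [h0, map_zero, zero_mul] at h2
      exact mul_ne_zero (pow_ne_zero s htF) hi h2.symm)
    (by
      rw [map_mul, MvPolynomial.aeval_X]
      refine mul_ne_zero (fun h0 => ?_) ht.ne_zero
      rw [h0, map_zero] at h3
      exact mul_ne_zero (pow_ne_zero s' htF) hg h3.symm)
  rw [map_mul, MvPolynomial.aeval_X] at hx'
  have hx0 : x none ≠ 0 := right_ne_zero_of_mul hx'
  have hxw : ∀ j, x (some j) = x (some j) / x none ^ r * x none ^ r := fun j =>
    (div_mul_cancel₀ _ (pow_ne_zero _ hx0)).symm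
  refine ⟨fun j => x (some j) / x none ^ r, ?_, ?_⟩
  · have := (hf' x _ hxw).1
    rw [hx] at this
    exact (mul_eq_zero.1 this.symm).resolve_left (pow_ne_zero _ hx0)
  · have := (hg' x _ hxw).1
    intro h0
    rw [h0, mul_zero] at this
    exact left_ne_zero_of_mul hx' this

/-- A standard étale presentation consists of univariate polynomials over a polynomial ring. This
lemma and the next read them as polynomials over K in which `none` is the distinguished variable. -/
lemma aeval_optionEquivLeft_symm {A τ : Type*} [CommRing A] [Algebra K A] (x : Option τ → A)
    (q : Polynomial (MvPolynomial τ K)) :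
    MvPolynomial.aeval x ((MvPolynomial.optionEquivLeft K τ).symm q) =
      q.eval₂ (MvPolynomial.aeval (R := K) fun j => x (some j)).toRingHom (x none) := by
  obtain ⟨p, rfl⟩ := (MvPolynomial.optionEquivLeft K τ).surjective q
  rw [AlgEquiv.symm_apply_apply]
  induction p using MvPolynomial.induction_on with
  | C c => simp
  | add p q hp hq => rw [map_add, map_add, Polynomial.eval₂_add, hp, hq]
  | mul_X p j hp =>
    rw [map_mul, map_mul, Polynomial.eval₂_mul, hp, MvPolynomial.aeval_X]
    cases j <;> simp

lemma pderiv_none_optionEquivLeft_symm {τ : Type*} (q : Polynomial (MvPolynomial τ K)) :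
    ((MvPolynomial.optionEquivLeft K τ).symm q).pderiv none =
      (MvPolynomial.optionEquivLeft K τ).symm (Polynomial.derivative q) := by
  classical
  obtain ⟨p, rfl⟩ := (MvPolynomial.optionEquivLeft K τ).surjective q
  rw [AlgEquiv.symm_apply_apply, AlgEquiv.eq_symm_apply]
  induction p using MvPolynomial.induction_on with
  | C c => simp
  | add p q hp hq => simp only [map_add, hp, hq]
  | mul_X p j hp =>
    simp only [Derivation.leibniz, map_add, map_mul, hp, smul_eq_mul, Polynomial.derivative_mul]
    cases j with
    | none => simp; ring
    | some j =>
      rw [MvPolynomial.pderiv_X_of_ne (by simp)]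
      simp; ring

/-- A finitely generated integral domain over `K` that embeds into the fraction field of a discrete
valuation ring with residue field `K` has a `K`-point, if `K` is large of characteristic zero. -/
theorem IsLarge.nonempty_algHom [CharZero K] (hK : IsLarge K) (ht : Irreducible t)
    (hV : ∀ v : V, ∃ c : K, t ∣ v - algebraMap K V c) {A : Type u} [CommRing A] [IsDomain A]
    [Algebra K A] [Algebra.FiniteType K A] (φ : A →ₐ[K] F) (hφ : Function.Injective φ) :
    Nonempty (A →ₐ[K] K) := by
  have : Algebra.FinitePresentation K A := Algebra.FinitePresentation.of_finiteType.1 inferInstance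
  -- In characteristic zero A is smooth at its generic point, hence after inverting one element a it
  -- is standard étale over a polynomial ring: a hypersurface f = 0 with f′ and g invertible.
  have : Algebra.EssFiniteType K (FractionRing A) := Algebra.EssFiniteType.comp K A _
  have hsm : Algebra.FormallySmooth K (FractionRing A) := inferInstance
  have : Algebra.IsSmoothAt K (⊥ : Ideal A) := by
    have hloc : IsLocalization (⊥ : Ideal A).primeCompl (FractionRing A) := by
      have : (⊥ : Ideal A).primeCompl = nonZeroDivisors A := by
        ext x; simp [Ideal.primeCompl]
      rw [this]; infer_instance
    exact Algebra.FormallySmooth.of_equiv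
      ((IsLocalization.algEquiv (⊥ : Ideal A).primeCompl (FractionRing A)
        (Localization.AtPrime (⊥ : Ideal A))).restrictScalars K)
  obtain ⟨a, ha, n, _, _, hse⟩ :=
    Algebra.IsSmoothAt.exists_isStandardEtale_mvPolynomial (R := K) (p := (⊥ : Ideal A))
  obtain ⟨P⟩ := hse.nonempty_standardEtalePresentation
  let S := Localization.Away a
  let ψ : S →ₐ[K] F := IsLocalization.liftAlgHom (M := Submonoid.powers a) (f := φ) (by
    rintro ⟨_, m, rfl⟩
    have : φ a ≠ 0 := by
      rw [Ne, map_eq_zero_iff φ hφ]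
      simpa using ha
    simpa using fun h => absurd h this)
  let w : Option (Fin n) → F := fun o =>
    o.elim (ψ P.x) fun j => ψ (algebraMap (MvPolynomial (Fin n) K) S (MvPolynomial.X j))
  have hw : ∀ q : Polynomial (MvPolynomial (Fin n) K),
      MvPolynomial.aeval w ((MvPolynomial.optionEquivLeft K (Fin n)).symm q) =
        ψ (Polynomial.aeval P.x q) := by
    intro q
    rw [aeval_optionEquivLeft_symm, Polynomial.aeval_def]
    have h := Polynomial.hom_eval₂ q (algebraMap (MvPolynomial (Fin n) K) S) ψ.toRingHom P.x
    have h2 : (MvPolynomial.aeval (R := K) fun j => w (some j)).toRingHom =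
        ψ.toRingHom.comp (algebraMap (MvPolynomial (Fin n) K) S) := by
      have : MvPolynomial.aeval (R := K) (fun j => w (some j)) =
          ψ.comp (IsScalarTower.toAlgHom K (MvPolynomial (Fin n) K) S) := by
        ext j; simp [w]
      rw [this]; rfl
    rw [h2]
    exact h.symm
  obtain ⟨x, hx, hx'⟩ := hK.exists_zero_of_fractionField ht hV
    ((MvPolynomial.optionEquivLeft K (Fin n)).symm P.f)
    ((MvPolynomial.optionEquivLeft K (Fin n)).symm P.g) w none
    (by rw [hw, P.hasMap.1, map_zero])
    (by
      rw [pderiv_none_optionEquivLeft_symm, hw]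
      exact (P.hasMap.isUnit_derivative_f.map ψ).ne_zero)
    (by
      rw [hw]
      exact (P.hasMap.2.map ψ).ne_zero)
  rw [aeval_optionEquivLeft_symm] at hx hx'
  -- The solution makes K an algebra over the polynomial ring, and the universal property of the
  -- presentation then gives the point.
  let : Algebra (MvPolynomial (Fin n) K) K :=
    (MvPolynomial.aeval (R := K) fun j => x (some j)).toRingHom.toAlgebra
  have : IsScalarTower K (MvPolynomial (Fin n) K) K :=
    IsScalarTower.of_algebraMap_eq fun c => by
      exact (MvPolynomial.aeval_C (R := K) (fun j => x (some j)) c).symm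
  let χ : P.Ring →ₐ[MvPolynomial (Fin n) K] K := P.lift (x none) ⟨hx, isUnit_iff_ne_zero.2 hx'⟩
  let θ : S →ₐ[MvPolynomial (Fin n) K] K := χ.comp P.equivRing.toAlgHom
  exact ⟨(θ.restrictScalars K).comp (IsScalarTower.toAlgHom K A S)⟩

/-- A large field of characteristic zero is existentially closed in the fraction field of any
discrete valuation ring with residue field `K`. -/
theorem IsLarge.isFieldEC [CharZero K] (hK : IsLarge K) (ht : Irreducible t)
    (hV : ∀ v : V, ∃ c : K, t ∣ v - algebraMap K V c) : IsFieldEC K F := by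
  classical
  rintro n E I ⟨a, hE, hI⟩
  let q : F := ∏ Q ∈ I, MvPolynomial.aeval a Q
  have hq : q ≠ 0 := Finset.prod_ne_zero_iff.2 hI
  -- Rabinowitsch's trick: with q⁻¹ in the algebra, any K-point keeps all the inequations true.
  let s : Set F := insert q⁻¹ (Set.range a)
  let A := Algebra.adjoin K s
  have hs : s.Finite := (Set.finite_range a).insert _
  have : Algebra.FiniteType K A :=
    (Subalgebra.fg_iff_finiteType _).1 (Subalgebra.fg_def.2 ⟨s, hs, rfl⟩)
  obtain ⟨χ⟩ := hK.nonempty_algHom ht hV A.val Subtype.val_injective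
  let b : Fin n → A := fun i => ⟨a i, Algebra.subset_adjoin (Or.inr ⟨i, rfl⟩)⟩
  have hb : ∀ P : MvPolynomial (Fin n) K,
      ((MvPolynomial.aeval b P : A) : F) = MvPolynomial.aeval a P := by
    intro P
    have : A.val.comp (MvPolynomial.aeval b) = MvPolynomial.aeval (R := K) a := by
      ext i; simp [b]
    rw [← this]; rfl
  have hχ : ∀ P : MvPolynomial (Fin n) K,
      MvPolynomial.aeval (fun i => χ (b i)) P = χ (MvPolynomial.aeval b P) := by
    intro P
    have : χ.comp (MvPolynomial.aeval b) = MvPolynomial.aeval (R := K) (fun i => χ (b i)) := by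
      ext i; simp
    rw [← this]; rfl
  refine ⟨fun i => χ (b i), fun P hP => ?_, fun Q hQ => ?_⟩
  · rw [hχ]
    have : MvPolynomial.aeval b P = 0 := Subtype.ext ((hb P).trans (hE P hP))
    rw [this, map_zero]
  · rw [hχ]
    let qi : A := ⟨q⁻¹, Algebra.subset_adjoin (Or.inl rfl)⟩
    have h1 : (∏ Q ∈ I, MvPolynomial.aeval b Q) * qi = 1 := by
      apply Subtype.ext
      have h2 : ((∏ Q ∈ I, MvPolynomial.aeval b Q : A) : F) = q := by
        rw [← Subalgebra.coe_val, map_prod]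
        exact Finset.prod_congr rfl fun Q _ => hb Q
      rw [MulMemClass.coe_mul, h2]
      exact mul_inv_cancel₀ hq
    have h2 := congrArg χ h1
    rw [map_mul, map_prod, map_one] at h2
    exact Finset.prod_ne_zero_iff.1 (left_ne_zero_of_mul_eq_one h2) Q hQ

end Fraction

end FieldEC

/-! ### Derivations as homomorphisms to dual numbers -/

section DualNumbers

/-- The differential ring structure given by an additive map that satisfies the Leibniz rule. -/
abbrev differentialOfLeibniz {R : Type*} [CommRing R] (D : R →+ R)
    (hD : ∀ a b, D (a * b) = a • D b + b • D a) : Differential R where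
  deriv := Derivation.mk' D.toIntLinearMap hD

/-- The derivation attached to a section of `R[ε] → R`. -/
abbrev differentialOfDualNumber {R : Type*} [CommRing R] (f : R →+* DualNumber R)
    (hf : ∀ r, (f r).fst = r) : Differential R :=
  differentialOfLeibniz
    { toFun := fun r => (f r).snd
      map_zero' := by simp
      map_add' := fun a b => by simp }
    (fun a b => by
      simp [TrivSqZeroExt.snd_mul, hf, mul_comm b])

lemma dualMap_apply {R S : Type u} [CommRing R] [CommRing S] (φ : R →+* S) (z : DualNumber R) :
    dualMap φ z = TrivSqZeroExt.inl (φ z.fst) + TrivSqZeroExt.inr (φ z.snd) := rfl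

lemma expDeriv_apply {R : Type u} [CommRing R] [Differential R] (r : R) :
    expDeriv R r = TrivSqZeroExt.inl r + TrivSqZeroExt.inr r′ := rfl

section FractionField

variable (V F : Type u) [CommRing V] [IsDomain V] [Differential V] [Field F] [Algebra V F]
  [IsFractionRing V F]

/-- The ring homomorphism `x ↦ x + δ(x) ε` on the fraction field of a differential ring. -/
def expDerivFractionField : F →+* DualNumber F :=
  IsLocalization.lift (M := nonZeroDivisors V)
    (g := (dualMap (algebraMap V F)).comp (expDeriv V)) (fun y => by
      -- A dual number is a unit when its first component is, so the universal property of
      -- localization replaces the quotient rule.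
      rw [TrivSqZeroExt.isUnit_iff_isUnit_fst]
      simp [dualMap_apply, expDeriv_apply])

lemma expDerivFractionField_algebraMap (v : V) : expDerivFractionField V F (algebraMap V F v) =
    TrivSqZeroExt.inl (algebraMap V F v) + TrivSqZeroExt.inr (algebraMap V F v′) := by
  refine (IsLocalization.lift_eq _ v).trans ?_
  simp [dualMap_apply, expDeriv_apply]

/-- The extension of a derivation to the fraction field. -/
abbrev differentialFractionField : Differential F :=
  differentialOfDualNumber (expDerivFractionField V F) (fun x => by
    have : (TrivSqZeroExt.fstHom F F F).toRingHom.comp (expDerivFractionField V F) =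
        RingHom.id F := by
      refine IsLocalization.ringHom_ext (nonZeroDivisors V) ?_
      ext v
      simp [expDerivFractionField_algebraMap]
    exact congr($this x))

lemma differentialAlgebra_fractionField :
    letI := differentialFractionField V F
    DifferentialAlgebra V F :=
  letI := differentialFractionField V F
  ⟨fun v => by
    change (expDerivFractionField V F _).snd = _
    rw [expDerivFractionField_algebraMap, TrivSqZeroExt.snd_add, TrivSqZeroExt.snd_inl,
      TrivSqZeroExt.snd_inr, zero_add]⟩

end FractionField

end DualNumbers

/-! ### Taylor expansion at a rational point -/

section Taylor

open PowerSeries in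
/-- The Taylor series `∑ p(δⁿ a) / n! Xⁿ`. -/
def taylorHom {A k : Type*} [CommRing A] [Differential A] [Field k] [CharZero k] (p : A →+* k) :
    A →+* k⟦X⟧ :=
  let T : A → k⟦X⟧ := fun a => .mk fun n => p ((fun x : A => x′)^[n] a) / n.factorial
  have hT : ∀ (n : ℕ) (a : A), ((n : k) + 1) * coeff (n + 1) (T a) = coeff n (T a′) := fun n a => by
    have h1 : (n.factorial : k) ≠ 0 := by exact_mod_cast n.factorial_ne_zero
    have h2 : (n + 1 : k) ≠ 0 := by exact_mod_cast n.succ_ne_zero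
    simp only [T, coeff_mk, Function.iterate_succ_apply, Nat.factorial_succ, Nat.cast_mul]
    push_cast
    field_simp
  have hadd : ∀ a b, T (a + b) = T a + T b := fun a b => by
    ext n
    simp [T, add_div]
  have h1 : T 1 = 1 := by
    ext n
    cases n with
    | zero => simp [T]
    | succ n =>
      have : (fun x : A => x′)^[n] (0 : A) = 0 :=
        Function.iterate_fixed (by simp) n
      simp [T, Function.iterate_succ_apply, this, coeff_one]
  -- T carries the derivation to d/dX, so both sides have derivatives given by the Leibniz rule;
  -- induction on the coefficient compares them.
  have hmul : ∀ a b, T (a * b) = T a * T b := fun a b => by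
    ext n
    induction n generalizing a b with
    | zero => simp [T]
    | succ n ih =>
      have h2 : (n + 1 : k) ≠ 0 := by exact_mod_cast n.succ_ne_zero
      have hd : ∀ a, d⁄dX k (T a) = T a′ := fun a => by
        ext m
        rw [coeff_derivative, ← hT, mul_comm]
      have h3 := congrArg (coeff n) ((d⁄dX k).leibniz (T a) (T b))
      rw [coeff_derivative, mul_comm, hd, hd] at h3
      refine mul_left_cancel₀ h2 ?_
      rw [h3, hT, Derivation.leibniz, smul_eq_mul, smul_eq_mul, hadd, map_add, ih, ih]
      simp
  { toFun := T
    map_one' := h1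
    map_mul' := hmul
    map_zero' := by simpa using hadd 0 0
    map_add' := hadd }

open PowerSeries in
lemma coeff_taylorHom {A k : Type*} [CommRing A] [Differential A] [Field k] [CharZero k]
    (p : A →+* k) (n : ℕ) (a : A) :
    coeff n (taylorHom p a) = p ((fun x : A => x′)^[n] a) / n.factorial := by
  simp [taylorHom]

open PowerSeries in
lemma derivative_taylorHom {A k : Type*} [CommRing A] [Differential A] [Field k] [CharZero k]
    (p : A →+* k) (a : A) : d⁄dX k (taylorHom p a) = taylorHom p a′ := by
  ext n
  have h1 : (n.factorial : k) ≠ 0 := by exact_mod_cast n.factorial_ne_zero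
  have h2 : (n + 1 : k) ≠ 0 := by exact_mod_cast n.succ_ne_zero
  rw [coeff_derivative, coeff_taylorHom, coeff_taylorHom, Function.iterate_succ_apply,
    Nat.factorial_succ]
  push_cast
  field_simp

/-- A differential `K`-algebra with a `K`-point `p` has a differential point, its Taylor expansion
at `p`, in a discrete valuation ring with residue field `K`: the power series ring over `K`, with
`K` embedded by Taylor series. -/
theorem exists_taylor_algHom {K : Type u} [Field K] [CharZero K] [Differential K] {A : Type u}
    [CommRing A] [Algebra K A] [Differential A] [DifferentialAlgebra K A] (p : A →ₐ[K] K) :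
    ∃ (V : Type u) (_ : CommRing V) (_ : IsDomain V) (_ : IsDiscreteValuationRing V)
      (_ : Algebra K V) (_ : Differential V) (_ : DifferentialAlgebra K V) (t : V),
      Irreducible t ∧ (∀ v : V, ∃ c : K, t ∣ v - algebraMap K V c) ∧
      ∃ T : A →ₐ[K] V, ∀ a, T a′ = (T a)′ := by
  have hcomm : ∀ c : K, taylorHom (p : A →+* K) (algebraMap K A c) =
      taylorHom (RingHom.id K) c := by
    intro c
    ext n
    have : (fun x : A => x′)^[n] (algebraMap K A c) =
        algebraMap K A ((fun x : K => x′)^[n] c) := by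
      induction n generalizing c with
      | zero => rfl
      | succ n ih => rw [Function.iterate_succ_apply, deriv_algebraMap, ih]; rfl
    rw [coeff_taylorHom, coeff_taylorHom, this]
    simp
  refine ⟨PowerSeries K, inferInstance, inferInstance, inferInstance,
    -- With the constant embedding of K, d/dX would vanish on K; with this one it extends δ.
    (taylorHom (RingHom.id K)).toAlgebra,
    differentialOfLeibniz (PowerSeries.derivative K).toLinearMap.toAddMonoidHom
      fun a b => (PowerSeries.derivative K).leibniz a b,
    @DifferentialAlgebra.mk _ _ _ _ (_) (_) (_) fun c => derivative_taylorHom (RingHom.id K) c,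
    PowerSeries.X, PowerSeries.X_prime.irreducible, fun v => ?_,
    @AlgHom.mk _ _ _ _ _ _ (_) (_) (taylorHom (p : A →+* K)) hcomm,
    fun a => (derivative_taylorHom (p : A →+* K) a).symm⟩
  refine ⟨PowerSeries.constantCoeff v, ?_⟩
  change PowerSeries.X ∣ v - taylorHom (RingHom.id K) (PowerSeries.constantCoeff v)
  rw [PowerSeries.X_dvd_iff, map_sub, sub_eq_zero,
    ← PowerSeries.coeff_zero_eq_constantCoeff_apply (taylorHom _ _), coeff_taylorHom]
  simp

end Taylor

/-! ### Differential points over a differentially large field -/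

section DifferentialPoints

variable {K : Type u} [Field K]

lemma diffEval_rename {A : Type u} [CommRing A] [Algebra K A] [Differential A] {n : ℕ}
    (a : Fin n → A) (P : MvPolynomial (Fin n) K) :
    diffEval a (MvPolynomial.rename (fun i => (i, 0)) P) = MvPolynomial.aeval a P := by
  rw [diffEval, MvPolynomial.aeval_rename]
  rfl

lemma diffEval_X_one {A : Type u} [CommRing A] [Algebra K A] [Differential A] {n : ℕ}
    (a : Fin n → A) (i : Fin n) :
    diffEval a (MvPolynomial.X (i, 1) : MvPolynomial (Fin n × ℕ) K) = (a i)′ := by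
  simp [diffEval]

variable [Differential K]
  {A : Type u} [CommRing A] [Algebra K A] [Differential A] [DifferentialAlgebra K A]

/-- A finitely generated differential algebra over `K` that is finitely generated as an algebra has
a differential `K`-point as soon as it has one in an extension in which `K` is existentially
closed. -/
theorem IsDiffEC.exists_algHom [Algebra.FiniteType K A] {L : Type u} [Field L] [Differential L]
    [Algebra K L] [DifferentialAlgebra K L] (hL : IsDiffEC K L) (φ : A →ₐ[K] L)
    (hφ : ∀ a, φ a′ = (φ a)′) : ∃ ψ : A →ₐ[K] K, ∀ a, ψ a′ = (ψ a)′ := by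
  classical
  obtain ⟨n, π, hπ⟩ := Algebra.FiniteType.iff_quotient_mvPolynomial''.1
    (inferInstance : Algebra.FiniteType K A)
  obtain ⟨J, hJ⟩ := (IsNoetherian.noetherian (RingHom.ker π) : (RingHom.ker π).FG)
  -- A differential point of A is a solution of finitely many equations: the relations J and Xⱼ′ =
  -- sⱼ(X), where sⱼ lifts the derivative of the j-th generator.
  choose s hs using fun j => hπ (π (MvPolynomial.X j))′
  let r : MvPolynomial (Fin n) K →ₐ[K] MvPolynomial (Fin n × ℕ) K :=
    MvPolynomial.rename fun i => (i, 0)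
  have hsub : ∀ {B : Type u} [CommRing B] [Algebra K B] [Differential B] (a : Fin n → B)
      (P Q : MvPolynomial (Fin n × ℕ) K), diffEval a (P - Q) = diffEval a P - diffEval a Q :=
    fun a P Q => map_sub (MvPolynomial.aeval _) P Q
  have hφπ : ∀ P, MvPolynomial.aeval (fun i => φ (π (MvPolynomial.X i))) P = φ (π P) := by
    intro P
    have : MvPolynomial.aeval (fun i => φ (π (MvPolynomial.X i))) = φ.comp π := by ext; simp
    rw [this]; rfl
  obtain ⟨a, ha, -⟩ := hL n (J.image r ∪ Finset.univ.image
      fun j => MvPolynomial.X (j, 1) - r (s j)) ∅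
    ⟨fun i => φ (π (MvPolynomial.X i)), by
      intro P hP
      rw [Finset.mem_union, Finset.mem_image, Finset.mem_image] at hP
      rcases hP with ⟨Q, hQ, rfl⟩ | ⟨j, -, rfl⟩
      · rw [diffEval_rename, hφπ]
        have : Q ∈ RingHom.ker π := hJ ▸ Ideal.subset_span hQ
        rw [RingHom.mem_ker.1 this, map_zero]
      · rw [hsub, diffEval_X_one, diffEval_rename, hφπ, hs, hφ, sub_self], by simp⟩
  have hker : ∀ P ∈ RingHom.ker π, MvPolynomial.aeval a P = 0 := by
    intro P hP
    rw [← hJ] at hP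
    have : Ideal.span (J : Set (MvPolynomial (Fin n) K)) ≤
        RingHom.ker (MvPolynomial.aeval a : _ →ₐ[K] K) := by
      rw [Ideal.span_le]
      intro Q hQ
      have := ha (r Q) (Finset.mem_union_left _ (Finset.mem_image_of_mem _ hQ))
      rwa [diffEval_rename] at this
    exact this hP
  let ψ : A →ₐ[K] K := AlgHom.liftOfSurjective π hπ (MvPolynomial.aeval a) hker
  have hψπ : ∀ P, ψ (π P) = MvPolynomial.aeval a P := fun P =>
    AlgHom.liftOfSurjective_apply _ _ _ _ _
  refine ⟨ψ, fun b => ?_⟩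
  obtain ⟨P, rfl⟩ := hπ b
  induction P using MvPolynomial.induction_on with
  | C c =>
    have : π (MvPolynomial.C c) = algebraMap K A c := π.commutes c
    rw [this, deriv_algebraMap, AlgHom.commutes, AlgHom.commutes]
    rfl
  | add P Q hP hQ => simp only [map_add, hP, hQ]
  | mul_X P j hP =>
    have hj : ψ (π (MvPolynomial.X j))′ = (ψ (π (MvPolynomial.X j)))′ := by
      have := ha (MvPolynomial.X (j, 1) - r (s j)) (Finset.mem_union_right _
        (Finset.mem_image_of_mem _ (Finset.mem_univ j)))
      rw [hsub, diffEval_X_one, diffEval_rename, sub_eq_zero] at this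
      rw [← hs, hψπ, hψπ, ← this, MvPolynomial.aeval_X]
    simp only [map_mul, Derivation.leibniz, smul_eq_mul, map_add, hP, hj]

/-- Over a differentially large field `K`, a differential `K`-algebra that is finitely generated as
a `K`-algebra has a differential `K`-point if it has a `K`-point. -/
theorem IsDifferentiallyLarge.exists_differential_algHom [CharZero K]
    (hK : IsDifferentiallyLarge K) [Algebra.FiniteType K A] (p : A →ₐ[K] K) :
    ∃ ψ : A →ₐ[K] K, ∀ a, ψ a′ = (ψ a)′ := by
  obtain ⟨V, _, _, _, _, _, _, t, ht, hV, T, hT⟩ := exists_taylor_algHom p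
  let F := FractionRing V
  let : Differential F := differentialFractionField V F
  have hVF : DifferentialAlgebra V F := differentialAlgebra_fractionField V F
  have : DifferentialAlgebra K F := ⟨fun c => by
    rw [IsScalarTower.algebraMap_apply K V F, deriv_algebraMap, deriv_algebraMap,
      ← IsScalarTower.algebraMap_apply]⟩
  have hec : IsFieldEC K F := hK.1.isFieldEC ht hV
  refine (hK.2 F hec).exists_algHom ((IsScalarTower.toAlgHom K V F).comp T) fun a => ?_
  have h : algebraMap V F (T a′) = (algebraMap V F (T a))′ := by rw [deriv_algebraMap, hT]
  exact h

end DifferentialPoints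

/-! ### Galois descent for algebras, by trace-dual bases -/

section GaloisDescent

variable {K L : Type*} [Field K] [Field L] [Algebra K L] [FiniteDimensional K L]

/-- The trace form of a separable extension is nondegenerate and symmetric. These bases make the
descent below explicit. -/
lemma exists_trace_dual_bases [Algebra.IsSeparable K L] :
    ∃ e d : Module.Basis (Fin (Module.finrank K L)) K L,
      (∀ l, ∑ i, Algebra.trace K L (l * e i) • d i = l) ∧
      (∀ l, ∑ i, Algebra.trace K L (l * d i) • e i = l) ∧
      ∀ i j, Algebra.trace K L (d i * e j) = if j = i then 1 else 0 := by
  let B := Algebra.traceForm K L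
  have hB : B.Nondegenerate := traceForm_nondegenerate K L
  have hsymm : B.IsSymm := Algebra.traceForm_isSymm K
  let e := Module.finBasis K L
  let d := B.dualBasis hB e
  have hsum : ∀ (b : Module.Basis (Fin (Module.finrank K L)) K L) (l : L),
      ∑ i, Algebra.trace K L (l * b i) • B.dualBasis hB b i = l := by
    intro b l
    conv_rhs => rw [← (B.dualBasis hB b).sum_repr l]
    refine Finset.sum_congr rfl fun i _ => ?_
    rw [LinearMap.BilinForm.dualBasis_repr_apply]
    rfl
  refine ⟨e, d, hsum e, fun l => ?_, fun i j => ?_⟩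
  · have := hsum d l
    rwa [LinearMap.BilinForm.dualBasis_dualBasis hB hsymm] at this
  · exact LinearMap.BilinForm.apply_dualBasis_left hB e i j

variable [IsGalois K L]

/-- Two embeddings of a Galois extension into a ring are locally conjugate. -/
lemma exists_conjugating_idempotents {R : Type*} [CommRing R] (α β : L →+* R)
    (h : ∀ c : K, α (algebraMap K L c) = β (algebraMap K L c)) :
    ∃ ε : Gal(L/K) → R, ∑ σ, ε σ = 1 ∧ ∀ σ l, ε σ * β l = ε σ * α (σ l) := by
  obtain ⟨e, d, hd, he, -⟩ := exists_trace_dual_bases (K := K) (L := L)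
  -- The image under (α∘σ) ⊗ β of the separability idempotent ∑ eᵢ ⊗ dᵢ of L ⊗ L, which is killed by
  -- l ⊗ 1 − 1 ⊗ l.
  refine ⟨fun σ => ∑ i, α (σ (e i)) * β (d i), ?_, fun σ l => ?_⟩
  · rw [Finset.sum_comm]
    have : ∀ i, ∑ σ : Gal(L/K), α (σ (e i)) * β (d i) =
        β (Algebra.trace K L (e i) • d i) := by
      intro i
      rw [← Finset.sum_mul, ← map_sum, ← trace_eq_sum_automorphisms, h, ← map_mul,
        Algebra.smul_def]
    rw [Finset.sum_congr rfl fun i _ => this i, ← map_sum]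
    have h1 := hd 1
    simp only [one_mul] at h1
    rw [h1, map_one]
  · have h1 : ∀ i, β (d i * l) = ∑ j, α (algebraMap K L (Algebra.trace K L (d i * l * e j))) *
        β (d j) := by
      intro i
      conv_lhs => rw [← hd (d i * l)]
      rw [map_sum]
      refine Finset.sum_congr rfl fun j _ => ?_
      rw [h, ← map_mul, Algebra.smul_def]
    have h2 : ∀ j, ∑ i, e i * algebraMap K L (Algebra.trace K L (d i * l * e j)) = e j * l := by
      intro j
      rw [← he (e j * l)]
      refine Finset.sum_congr rfl fun i _ => ?_
      rw [Algebra.smul_def, mul_comm, show d i * l * e j = e j * l * d i by ring]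
    calc (∑ i, α (σ (e i)) * β (d i)) * β l = ∑ i, α (σ (e i)) * β (d i * l) := by
          rw [Finset.sum_mul]
          exact Finset.sum_congr rfl fun i _ => by rw [map_mul, mul_assoc]
      _ = ∑ j, α (σ (∑ i, e i * algebraMap K L (Algebra.trace K L (d i * l * e j)))) *
          β (d j) := by
          simp only [h1, Finset.mul_sum, map_sum, Finset.sum_mul, map_mul, AlgEquiv.commutes]
          rw [Finset.sum_comm]
          exact Finset.sum_congr rfl fun i _ => Finset.sum_congr rfl fun j _ => by ring
      _ = (∑ i, α (σ (e i)) * β (d i)) * α (σ l) := by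
          simp only [h2, map_mul, Finset.sum_mul]
          exact Finset.sum_congr rfl fun i _ => by ring

variable {B : Type*} [CommRing B] [Algebra K B] [Algebra L B]

/-- The subalgebra of invariants of a group of algebra endomorphisms. -/
def invariants {Γ : Type*} [Monoid Γ] (act : Γ →* (B →ₐ[K] B)) : Subalgebra K B where
  carrier := {b | ∀ σ, act σ b = b}
  mul_mem' ha hb σ := by rw [map_mul, ha, hb]
  add_mem' ha hb σ := by rw [map_add, ha, hb]
  algebraMap_mem' c σ := AlgHom.commutes _ c

variable (act : Gal(L/K) →* (B →ₐ[K] B))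

/-- The sum of the conjugates. -/
def traceInvariants (b : B) : invariants act :=
  ⟨∑ σ, act σ b, fun ρ => by
    rw [map_sum]
    refine Fintype.sum_equiv (Equiv.mulLeft ρ) _ _ fun σ => ?_
    rw [Equiv.coe_mulLeft, map_mul]
    rfl⟩

/-- Galois descent for algebras: an algebra over `L` with a semilinear action of the Galois group is
generated by its invariants as an `L`-module, with explicit coordinates. -/
lemma sum_traceInvariants_mul
    (hact : ∀ σ l, act σ (algebraMap L B l) = algebraMap L B (σ l))
    (e d : Module.Basis (Fin (Module.finrank K L)) K L)
    (hd : ∀ l, ∑ i, Algebra.trace K L (l * e i) • d i = l) (b : B) :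
    ∑ i, (traceInvariants act (algebraMap L B (e i) * b) : B) * algebraMap L B (d i) = b := by
  classical
  -- By Dedekind's independence of automorphisms it suffices to compare the two combinations ∑ c_σ σ
  -- as maps; both are the identity, by the trace expansion `hd`.
  have hδ : ∀ σ : Gal(L/K), ∑ i, σ (e i) * d i = if σ = 1 then 1 else 0 := by
    have hli := linearIndependent_toLinearMap K L L
    have h1 : ∑ σ : Gal(L/K), (∑ i, σ (e i) * d i) • (σ : L →ₐ[K] L).toLinearMap =
        ∑ σ : Gal(L/K), (if σ = 1 then (1 : L) else 0) • (σ : L →ₐ[K] L).toLinearMap := by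
      ext l
      simp only [LinearMap.sum_apply, LinearMap.smul_apply, smul_eq_mul, ite_mul, one_mul, zero_mul,
        Finset.sum_ite_eq', Finset.mem_univ, if_true]
      have : ∀ σ : Gal(L/K), (∑ i, σ (e i) * d i) * σ l = ∑ i, σ (l * e i) * d i := by
        intro σ
        rw [Finset.sum_mul]
        exact Finset.sum_congr rfl fun i _ => by rw [map_mul]; ring
      change ∑ σ : Gal(L/K), (∑ i, σ (e i) * d i) * σ l = l
      simp only [this]
      rw [Finset.sum_comm]
      conv_rhs => rw [← hd l]
      refine Finset.sum_congr rfl fun i _ => ?_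
      rw [← Finset.sum_mul, ← trace_eq_sum_automorphisms, Algebra.smul_def]
    have hli' : LinearIndependent L (fun σ : Gal(L/K) => (σ : L →ₐ[K] L).toLinearMap) :=
      hli.comp (fun σ : Gal(L/K) => (σ : L →ₐ[K] L)) fun σ τ h => by
        ext x; exact congr($h x)
    intro σ
    have h2 := Fintype.linearIndependent_iff.1 hli'
      (fun σ => (∑ i, σ (e i) * d i) - if σ = 1 then 1 else 0) (by
        simp only [sub_smul, Finset.sum_sub_distrib, h1, sub_self]) σ
    exact sub_eq_zero.1 h2
  change ∑ i, (∑ σ, act σ (algebraMap L B (e i) * b)) * algebraMap L B (d i) = b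
  calc _ = ∑ σ, algebraMap L B (∑ i, σ (e i) * d i) * act σ b := by
        simp only [Finset.sum_mul, map_sum, map_mul, hact]
        rw [Finset.sum_comm]
        exact Finset.sum_congr rfl fun i _ => Finset.sum_congr rfl fun σ _ => by ring
    _ = b := by
        simp [hδ]

/-- Artin–Tate: B is of finite type over K and is spanned over the invariants by the finitely many
dᵢ. -/
lemma finiteType_invariants
    (hact : ∀ σ l, act σ (algebraMap L B l) = algebraMap L B (σ l))
    [Algebra.FiniteType K B] :
    Algebra.FiniteType K (invariants act) := by
  obtain ⟨e, d, hd, -, -⟩ := exists_trace_dual_bases (K := K) (L := L)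
  refine ⟨fg_of_fg_of_fg K (invariants act) B (Algebra.FiniteType.out) ?_ Subtype.val_injective⟩
  rw [Submodule.fg_def]
  refine ⟨Set.range fun i => algebraMap L B (d i), Set.finite_range _, ?_⟩
  rw [eq_top_iff]
  intro b _
  rw [← sum_traceInvariants_mul act hact e d hd b]
  refine Submodule.sum_mem _ fun i _ => ?_
  exact Submodule.smul_mem _ _ (Submodule.subset_span ⟨i, rfl⟩)

variable [IsScalarTower K L B]

lemma traceInvariants_algebraMap
    (hact : ∀ σ l, act σ (algebraMap L B l) = algebraMap L B (σ l))
    (a : invariants act) (l : L) :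
    traceInvariants act (a * algebraMap L B l) =
      a * algebraMap K (invariants act) (Algebra.trace K L l) := by
  apply Subtype.ext
  change ∑ σ, act σ (a * algebraMap L B l) = (a : B) * algebraMap K B (Algebra.trace K L l)
  rw [IsScalarTower.algebraMap_apply K L B, trace_eq_sum_automorphisms, map_sum, Finset.mul_sum]
  exact Finset.sum_congr rfl fun σ _ => by rw [map_mul, a.2 σ, hact]

/-- A point of the algebra of invariants extends to a semilinear equivariant point. -/
theorem exists_equivariant_extension
    (hact : ∀ σ l, act σ (algebraMap L B l) = algebraMap L B (σ l))
    (ψ : invariants act →ₐ[K] K) :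
    ∃ Ψ : B →ₐ[K] L, (∀ l, Ψ (algebraMap L B l) = l) ∧
      (∀ a : invariants act, Ψ a = algebraMap K L (ψ a)) ∧ ∀ σ b, Ψ (act σ b) = σ (Ψ b) := by
  classical
  obtain ⟨e, d, hd, -, hed⟩ := exists_trace_dual_bases (K := K) (L := L)
  let A := invariants act
  let m : TensorProduct K A L →ₐ[K] B :=
    Algebra.TensorProduct.lift A.val (IsScalarTower.toAlgHom K L B) fun _ _ => mul_comm _ _
  have hm : ∀ a l, m (a ⊗ₜ l) = a * algebraMap L B l := fun a l =>
    Algebra.TensorProduct.lift_tmul _ _ _ a l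
  let g : TensorProduct K A L →ₐ[K] L :=
    Algebra.TensorProduct.lift ((Algebra.ofId K L).comp ψ) (AlgHom.id K L) fun _ _ => mul_comm _ _
  have hg : ∀ a l, g (a ⊗ₜ l) = algebraMap K L (ψ a) * l := fun a l =>
    Algebra.TensorProduct.lift_tmul _ _ _ a l
  -- The coordinates of z in the basis 1 ⊗ dⱼ are the traces of m(z)·eⱼ, by duality.
  have hinj : Function.Injective m := by
    rw [injective_iff_map_eq_zero]
    intro z hz
    let bA : Module.Basis _ A (TensorProduct K A L) := Algebra.TensorProduct.basis A d
    rw [← bA.sum_repr z] at hz ⊢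
    have hb : ∀ (a : A) i, a • bA i = a ⊗ₜ d i := fun a i => by
      rw [Algebra.TensorProduct.basis_apply, TensorProduct.smul_tmul', smul_eq_mul, mul_one]
    simp only [hb, map_sum, hm] at hz
    have hrepr : ∀ j, bA.repr z j = 0 := by
      intro j
      have h0 : traceInvariants act ((∑ i, (bA.repr z i : B) * algebraMap L B (d i)) *
          algebraMap L B (e j)) = 0 := by
        rw [hz, zero_mul]
        apply Subtype.ext
        change ∑ σ, act σ 0 = 0
        simp
      have hadd : ∀ f : Fin (Module.finrank K L) → B, traceInvariants act (∑ i, f i) =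
          ∑ i, traceInvariants act (f i) := by
        intro f
        apply Subtype.ext
        rw [← Subalgebra.coe_val, map_sum]
        change ∑ σ, act σ (∑ i, f i) = ∑ i, ∑ σ, act σ (f i)
        rw [Finset.sum_comm]
        exact Finset.sum_congr rfl fun σ _ => map_sum _ _ _
      rw [Finset.sum_mul, hadd] at h0
      simp only [mul_assoc, ← map_mul, traceInvariants_algebraMap act hact, hed] at h0
      simpa using h0
    simp [hrepr]
  have hsurj : Function.Surjective m := by
    intro b
    refine ⟨∑ i, traceInvariants act (algebraMap L B (e i) * b) ⊗ₜ d i, ?_⟩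
    simp only [map_sum, hm]
    exact sum_traceInvariants_mul act hact e d hd b
  let E := AlgEquiv.ofBijective m ⟨hinj, hsurj⟩
  let Ψ : B →ₐ[K] L := g.comp E.symm.toAlgHom
  have hΨ : ∀ z, Ψ (m z) = g z := fun z => by
    change g (E.symm (E z)) = g z
    rw [AlgEquiv.symm_apply_apply]
  refine ⟨Ψ, fun l => ?_, fun a => ?_, fun σ b => ?_⟩
  · have := hΨ (1 ⊗ₜ l)
    rw [hm, hg] at this
    simpa using this
  · have := hΨ (a ⊗ₜ 1)
    rw [hm, hg] at this
    simpa using this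
  · obtain ⟨z, rfl⟩ := hsurj b
    induction z with
    | zero => simp
    | add x y hx hy => simp only [map_add, hx, hy]
    | tmul a l =>
      have h1 : act σ (m (a ⊗ₜ l)) = m (a ⊗ₜ σ l) := by
        rw [hm, hm, map_mul, a.2 σ, hact]
      rw [h1, hΨ, hΨ, hg, hg, map_mul, AlgEquiv.commutes]

end GaloisDescent

/-! ### Differentially closed fields are algebraically closed -/

section DifferentiallyClosed

/-- A differentially closed field of characteristic zero is algebraically closed. -/
theorem IsDifferentiallyClosed.isAlgClosed {U : Type u} [Field U] [CharZero U] [Differential U]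
    (hU : IsDifferentiallyClosed U) : IsAlgClosed U := by
  refine IsAlgClosed.of_exists_root _ fun p hp hirr => ?_
  have : Fact (Irreducible p) := ⟨hirr⟩
  have : Fact p.Monic := ⟨hp⟩
  let q : MvPolynomial (Fin 1) U := Polynomial.aeval (MvPolynomial.X 0) p
  have hq : ∀ {A : Type u} [CommRing A] [Algebra U A] (a : Fin 1 → A),
      MvPolynomial.aeval a q = Polynomial.aeval (a 0) p := by
    intro A _ _ a
    rw [← Polynomial.aeval_algHom_apply, MvPolynomial.aeval_X]
  -- The derivation extends to `AdjoinRoot p`, where p has a root; the equation involves no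
  -- derivatives.
  obtain ⟨a, ha, -⟩ := hU (AdjoinRoot p) 1 {MvPolynomial.rename (fun i => (i, 0)) q} ∅
    ⟨fun _ => AdjoinRoot.root p, by simp [diffEval_rename, hq], by simp⟩
  have := ha _ (Finset.mem_singleton_self _)
  rw [diffEval_rename, hq, Polynomial.coe_aeval_eq_eval] at this
  exact ⟨a 0, this⟩

end DifferentiallyClosed

/-! ### Functoriality of prolongations and of ∇ -/

section Prolongation

variable {K : Type u} [Field K] [Differential K]
variable {R S T : Type u} [CommRing R] [Algebra K R] [CommRing S] [Algebra K S]
  [CommRing T] [Algebra K T]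

lemma prolongMap_comp (φ : R →ₐ[K] S) (ψ : S →ₐ[K] T) :
    prolongMap ψ ≫ prolongMap φ = prolongMap (ψ.comp φ) := by
  ext1
  simp only [prolongMap, Over.comp_left, Over.homMk_left]
  rw [← Spec.map_comp, ← CommRingCat.ofHom_comp]
  congr 2
  ext z <;> simp [dualMap_apply]

lemma prolongMap_id : prolongMap (AlgHom.id K R) = 𝟙 (prolongSpec K R) := by
  ext1
  refine Eq.trans ?_ (Spec.map_id _)
  simp only [prolongMap, Over.homMk_left]
  congr 1
  ext z <;> simp [dualMap_apply]

lemma prolongIncl_prolongMap (φ : R →ₐ[K] S) :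
    prolongIncl S ≫ prolongMap φ = specMap φ ≫ prolongIncl R := by
  ext1
  simp only [prolongMap, prolongIncl, specMap, Over.comp_left, Over.homMk_left]
  rw [← Spec.map_comp, ← Spec.map_comp, ← CommRingCat.ofHom_comp, ← CommRingCat.ofHom_comp]
  congr 2
  refine RingHom.ext fun z => ?_
  simp [dualMap_apply]

lemma prolongIncl_nablaSpec [Differential R] [DifferentialAlgebra K R] :
    prolongIncl R ≫ nablaSpec R = 𝟙 (specOver K R) := by
  ext1
  simp only [nablaSpec, prolongIncl, Over.comp_left, Over.homMk_left]
  rw [← Spec.map_comp, ← CommRingCat.ofHom_comp]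
  refine Eq.trans ?_ (Spec.map_id _)
  congr 1
  ext z
  simp [expDeriv_apply]

lemma prolongMap_nablaSpec [Differential R] [DifferentialAlgebra K R]
    [Differential S] [DifferentialAlgebra K S] (φ : R →ₐ[K] S) (hφ : ∀ a, φ a′ = (φ a)′) :
    prolongMap φ ≫ nablaSpec R = nablaSpec S ≫ specMap φ := by
  ext1
  simp only [nablaSpec, prolongMap, specMap, Over.comp_left, Over.homMk_left]
  rw [← Spec.map_comp, ← Spec.map_comp, ← CommRingCat.ofHom_comp, ← CommRingCat.ofHom_comp]
  congr 2
  ext z <;> simp [expDeriv_apply, dualMap_apply, hφ]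

/-- The ε-components of the two composites are φ(a′) and φ(a)′. This translates geometric
compatibility with D-structures back into algebra. -/
lemma deriv_algHom_of_prolongMap_nablaSpec [Differential R] [DifferentialAlgebra K R]
    [Differential S] [DifferentialAlgebra K S] (φ : R →ₐ[K] S)
    (h : prolongMap φ ≫ nablaSpec R = nablaSpec S ≫ specMap φ) (a : R) : φ a′ = (φ a)′ := by
  have h' := congr(($h).left)
  simp only [nablaSpec, prolongMap, specMap, Over.comp_left, Over.homMk_left] at h'
  rw [← Spec.map_comp, ← Spec.map_comp] at h'
  have := congr((($(Spec.map_injective h') : _ → _) a : DualNumber S).snd)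
  simpa [expDeriv_apply, dualMap_apply] using this

lemma nabla_specMap {X : Over (Spec (CommRingCat.of K))} [Differential R] [DifferentialAlgebra K R]
    [Differential S] [DifferentialAlgebra K S] (φ : R →ₐ[K] S) (hφ : ∀ a, φ a′ = (φ a)′)
    (x : specOver K R ⟶ X) : nabla (specMap φ ≫ x) = prolongMap φ ≫ nabla x := by
  rw [nabla, nabla, ← Category.assoc, ← prolongMap_nablaSpec φ hφ, Category.assoc]

lemma tauProj_nabla {X : Over (Spec (CommRingCat.of K))} [Differential R] [DifferentialAlgebra K R]
    (x : specOver K R ⟶ X) : tauProj (nabla x) = x := by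
  rw [tauProj, nabla, ← Category.assoc, prolongIncl_nablaSpec, Category.id_comp]

/-- A section of `Spec R ⟶ Spec R[ε]` is given by a derivation. -/
lemma exists_differential (t : prolongSpec K R ⟶ specOver K R)
    (ht : prolongIncl R ≫ t = 𝟙 (specOver K R)) :
    ∃ (_ : Differential R) (_ : DifferentialAlgebra K R), t = nablaSpec R := by
  obtain ⟨f, hf⟩ : ∃ f : R →+* DualNumber R, Spec.map (CommRingCat.ofHom f) = t.left :=
    ⟨(Spec.preimage t.left).hom, Spec.map_preimage _⟩
  have h1 : ∀ r, (f r).fst = r := fun r => by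
    have h := congr(($ht).left)
    rw [Over.comp_left, ← hf] at h
    simp only [prolongIncl, Over.homMk_left] at h
    rw [← Spec.map_comp] at h
    exact congr(($(Spec.map_injective (h.trans (Spec.map_id _).symm)) : _ → _) r)
  have h2 : ∀ c : K, f (algebraMap K R c) = twist K R c := fun c => by
    have h := Over.w t
    rw [← hf] at h
    simp only [Over.mk_hom] at h
    rw [← Spec.map_comp] at h
    exact congr(($(Spec.map_injective h) : _ → _) c)
  refine ⟨differentialOfDualNumber f h1, ?_, ?_⟩
  · let := differentialOfDualNumber f h1
    refine ⟨fun c => ?_⟩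
    change (f (algebraMap K R c)).snd = _
    rw [h2]
    exact zero_add _
  · ext1
    rw [← hf]
    simp only [nablaSpec, Over.homMk_left]
    congr 2
    ext r
    · simp [expDeriv_apply, h1]
    · simp only [expDeriv_apply, TrivSqZeroExt.snd_add, TrivSqZeroExt.snd_inl,
        TrivSqZeroExt.snd_inr, zero_add]
      rfl

/-- Since ε is nilpotent, Spec R and Spec R[ε] have the same points. Hence a prolonged point lies in
an open subscheme once its projection does, and D-structures restrict to opens. -/
lemma range_prolongIncl_comp {X : Over (Spec (CommRingCat.of K))} (t : prolongSpec K R ⟶ X) :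
    Set.range (prolongIncl R ≫ t).left = Set.range t.left := by
  have h : Function.Surjective (prolongIncl (K := K) R).left := by
    refine Set.range_eq_univ.1 ((range_comap_of_surjective _ (TrivSqZeroExt.fstHom R R R).toRingHom
      fun r => ⟨TrivSqZeroExt.inl r, rfl⟩).trans (Set.eq_univ_iff_forall.2 fun p z hz => ?_))
    have hz' : z.fst = 0 := hz
    refine p.isPrime.mem_of_pow_mem 2 ?_
    have : z ^ 2 = 0 := by
      ext <;> simp [pow_two, hz']
    rw [this]
    exact p.asIdeal.zero_mem
  rw [Over.comp_left, Scheme.Hom.comp_base, TopCat.coe_comp, Set.range_comp, h.range_eq,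
    Set.image_univ]

end Prolongation

/-! ### Affine charts and torsor arithmetic -/

section Charts

variable {K : Type u} [Field K]

lemma exists_chart {X : Over (Spec (CommRingCat.of K))} {W : X.left.Opens} (hW : IsAffineOpen W) :
    ∃ (R : Type u) (_ : CommRing R) (_ : Algebra K R) (j : specOver K R ⟶ X),
      IsOpenImmersion j.left ∧ Set.range j.left = W ∧
      (LocallyOfFiniteType X.hom → Algebra.FiniteType K R) := by
  let φ : K →+* Γ(X.left, W) := (Spec.preimage (hW.fromSpec ≫ X.hom)).hom
  let : Algebra K Γ(X.left, W) := φ.toAlgebra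
  have hφ : Spec.map (CommRingCat.ofHom (algebraMap K Γ(X.left, W))) = hW.fromSpec ≫ X.hom :=
    Spec.map_preimage _
  refine ⟨Γ(X.left, W), inferInstance, inferInstance, Over.homMk hW.fromSpec hφ.symm, ?_, ?_, ?_⟩
  · exact inferInstanceAs (IsOpenImmersion hW.fromSpec)
  · exact hW.range_fromSpec
  · intro h
    have : LocallyOfFiniteType (hW.fromSpec ≫ X.hom) := inferInstance
    rw [← hφ, HasRingHomProperty.Spec_iff (P := @LocallyOfFiniteType)] at this
    simpa [RingHom.finiteType_algebraMap] using this

lemma exists_lift {X V T : Over (Spec (CommRingCat.of K))} (j : V ⟶ X) [IsOpenImmersion j.left]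
    (f : T ⟶ X) (h : Set.range f.left ⊆ Set.range j.left) : ∃ g : T ⟶ V, g ≫ j = f :=
  ⟨Over.homMk (IsOpenImmersion.lift j.left f.left h) (by
    rw [← Over.w j, IsOpenImmersion.lift_fac_assoc, Over.w]),
    by ext1; exact IsOpenImmersion.lift_fac _ _ _⟩

lemma mono_of_isOpenImmersion_left {X V : Over (Spec (CommRingCat.of K))} (j : V ⟶ X)
    [IsOpenImmersion j.left] : Mono j :=
  Over.mono_of_mono_left j

lemma left_apply_eq_location {X : Over (Spec (CommRingCat.of K))} {R : Type u} [Field R]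
    [Algebra K R] (a : specOver K R ⟶ X) (x : (specOver K R).left) : a.left x = location a := by
  have : Subsingleton (specOver K R).left := inferInstanceAs (Subsingleton (PrimeSpectrum R))
  exact congrArg a.left (Subsingleton.elim _ _)

end Charts

section Torsors

variable {K : Type u} [Field K] {G X : Over (Spec (CommRingCat.of K))} [GrpObj G] [ModObj G X]

lemma IsAlgTorsor.smul_right_cancel (hX : IsAlgTorsor G X) {T : Over (Spec (CommRingCat.of K))}
    {g h : T ⟶ G} {x : T ⟶ X} (e : g • x = h • x) : g = h :=
  (hX.existsUnique_smul_eq T x (h • x)).unique e rfl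

lemma IsAlgTorsor.exists_smul_eq (hX : IsAlgTorsor G X) {T : Over (Spec (CommRingCat.of K))}
    (x y : T ⟶ X) : ∃ g : T ⟶ G, g • x = y :=
  (hX.existsUnique_smul_eq T x y).exists

end Torsors

/-! ### Equivariant sharp points -/

section EquivariantPoints

variable {K L : Type u} [Field K] [CharZero K] [Differential K] [Field L] [Algebra K L]
  [FiniteDimensional K L] [IsGalois K L] [Differential L] [DifferentialAlgebra K L]

/-- A differential algebra over a finite Galois extension of a differentially large field, with a
semilinear Galois action, has an equivariant differential point as soon as it has an equivariant
point. -/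
theorem IsDifferentiallyLarge.exists_equivariant_differential_algHom
    (hK : IsDifferentiallyLarge K)
    {B : Type u} [CommRing B] [Algebra K B] [Algebra L B] [IsScalarTower K L B]
    [Algebra.FiniteType K B] [Differential B] [DifferentialAlgebra K B]
    (hB : ∀ l : L, algebraMap L B l′ = (algebraMap L B l)′)
    (act : Gal(L/K) →* (B →ₐ[K] B))
    (hact : ∀ σ l, act σ (algebraMap L B l) = algebraMap L B (σ l))
    (hder : ∀ σ b, act σ b′ = (act σ b)′)
    (p : B →ₐ[K] L) (hp : ∀ σ b, p (act σ b) = σ (p b)) :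
    ∃ Ψ : B →ₐ[K] L, (∀ l, Ψ (algebraMap L B l) = l) ∧ (∀ σ b, Ψ (act σ b) = σ (Ψ b)) ∧
      ∀ b, Ψ b′ = (Ψ b)′ := by
  -- An equivariant point sends invariants to the fixed field K, so the algebra of invariants has a
  -- K-point.
  have hfix : ∀ a : invariants act, p a ∈ (⊥ : IntermediateField K L) := fun a => by
    rw [IsGalois.mem_bot_iff_fixed]
    intro σ
    rw [← hp, a.2 σ]
  have hmem : ∀ a : invariants act, (a : B)′ ∈ invariants act := fun a σ => by
    rw [hder, a.2 σ]
  let D : invariants act →+ invariants act :=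
    { toFun := fun a => ⟨(a : B)′, hmem a⟩
      map_zero' := Subtype.ext (by simp)
      map_add' := fun a b => Subtype.ext (by simp) }
  let : Differential (invariants act) := differentialOfLeibniz D fun a b => Subtype.ext (by
    simp [D])
  have hD : ∀ a : invariants act, ((a′ : invariants act) : B) = (a : B)′ := fun a => rfl
  have : DifferentialAlgebra K (invariants act) := ⟨fun c => Subtype.ext (by
    rw [hD]
    exact deriv_algebraMap c)⟩
  have := finiteType_invariants act hact
  let p' : invariants act →ₐ[K] K := (IntermediateField.botEquiv K L).toAlgHom.comp
    ((p.comp (invariants act).val).codRestrict (⊥ : IntermediateField K L).toSubalgebra hfix)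
  obtain ⟨ψ, hψ⟩ := hK.exists_differential_algHom p'
  obtain ⟨Ψ, h1, h2, h3⟩ := exists_equivariant_extension act hact ψ
  refine ⟨Ψ, h1, h3, fun b => ?_⟩
  -- Compatibility with derivations is known on the invariants and on L, which together generate B.
  obtain ⟨e, d, hd, -, -⟩ := exists_trace_dual_bases (K := K) (L := L)
  rw [← sum_traceInvariants_mul act hact e d hd b]
  simp only [map_sum, Derivation.leibniz, map_mul, map_add, smul_eq_mul, ← hB, h1, ← hD, h2, hψ,
    deriv_algebraMap]

/-- A scheme over a finite Galois extension of a differentially large field, with a D-structure and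
a semilinear Galois action that preserves it, has an equivariant sharp point as soon as it has an
equivariant point. -/
theorem IsDifferentiallyLarge.exists_equivariant_sharp (hK : IsDifferentiallyLarge K)
    {E : Over (Spec (CommRingCat.of K))} [LocallyOfFiniteType E.hom] [IsSeparated E.hom]
    (q : E ⟶ specOver K L) (v : DStructure E)
    (hv : ∀ {R : Type u} [CommRing R] [Algebra K R] (b : specOver K R ⟶ E),
      v.sec b ≫ q = prolongMap (algHomOf (b ≫ q)) ≫ nablaSpec L)
    (τ : Gal(L/K) → (E ⟶ E)) (hτ_one : τ 1 = 𝟙 E) (hτ : ∀ σ ρ, τ σ ≫ τ ρ = τ (σ * ρ))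
    (hq : ∀ σ, τ σ ≫ q = q ≫ specMap (σ : L →ₐ[K] L))
    (hτv : ∀ σ {R : Type u} [CommRing R] [Algebra K R] (b : specOver K R ⟶ E),
      v.sec (b ≫ τ σ) = v.sec b ≫ τ σ)
    (P₀ : specOver K L ⟶ E) (hP₀ : ∀ σ, P₀ ≫ τ σ = specMap (σ : L →ₐ[K] L) ≫ P₀) :
    ∃ P : specOver K L ⟶ E, P ≫ q = 𝟙 _ ∧ (∀ σ, P ≫ τ σ = specMap (σ : L →ₐ[K] L) ≫ P) ∧
      nabla P = v.sec P := by
  obtain ⟨V, hV, hPV⟩ : ∃ V : E.left.Opens, IsAffineOpen V ∧ location P₀ ∈ V := by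
    obtain ⟨V, hV, hx, -⟩ := exists_isAffineOpen_mem_and_subset (X := E.left) (x := location P₀)
      (U := ⊤) trivial
    exact ⟨V, hV, hx⟩
  -- A Galois-stable neighbourhood of P₀, affine because E is separated. It contains P₀ because Spec
  -- L has a single point, so equivariance makes every τ σ fix the location of P₀.
  let N : E.left.Opens := ⨅ σ, (τ σ).left ⁻¹ᵁ V
  have hmemN : ∀ x, x ∈ N ↔ ∀ σ, (τ σ).left x ∈ V := fun x => by
    change x ∈ ((⨅ σ, (τ σ).left ⁻¹ᵁ V : E.left.Opens) : Set E.left) ↔ _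
    rw [TopologicalSpace.Opens.coe_iInf, Set.mem_iInter]
    rfl
  have hN : IsAffineOpen N := by
    have : E.left.IsSeparated := by
      rw [Scheme.isSeparated_iff, ← Limits.terminal.comp_from E.hom]
      infer_instance
    refine IsAffineOpen.iInf fun σ => ?_
    have : IsIso (τ σ) := ⟨τ σ⁻¹, by rw [hτ, mul_inv_cancel, hτ_one],
      by rw [hτ, inv_mul_cancel, hτ_one]⟩
    have : IsIso (τ σ).left := inferInstanceAs (IsIso ((Over.forget _).map (τ σ)))
    exact hV.preimage_of_isIso (τ σ).left
  obtain ⟨B, _, _, j, _, hj, hfin⟩ := exists_chart hN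
  have hfin := hfin inferInstance
  have := mono_of_isOpenImmersion_left j
  have hs : ∀ σ, ∃ s : specOver K B ⟶ specOver K B, s ≫ j = j ≫ τ σ := fun σ => by
    refine exists_lift j _ ?_
    rw [hj, Over.comp_left]
    rintro _ ⟨x, rfl⟩
    have hx : j.left x ∈ N := hj.le ⟨x, rfl⟩
    refine (hmemN _).2 fun ρ => ?_
    have := (hmemN _).1 hx (σ * ρ)
    rw [← hτ] at this
    exact this
  choose s hs using hs
  have hs_mul : ∀ σ ρ, s σ ≫ s ρ = s (σ * ρ) := fun σ ρ => by
    rw [← cancel_mono j, Category.assoc, hs, reassoc_of% (hs σ), hs, hτ]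
  let act : Gal(L/K) →* (B →ₐ[K] B) :=
    { toFun := fun σ => algHomOf (s σ)
      map_one' := specMap_injective (by
        rw [specMap_algHomOf, ← cancel_mono j, hs, hτ_one, Category.comp_id]
        refine Eq.trans (Category.id_comp _).symm ?_
        congr 1
        exact specMap_id.symm)
      map_mul' := fun σ ρ => specMap_injective (by
        rw [specMap_algHomOf, ← hs_mul]
        refine Eq.trans ?_ (specMap_comp _ _)
        rw [specMap_algHomOf, specMap_algHomOf]) }
  have hact_j : ∀ σ, specMap (act σ) ≫ j = j ≫ τ σ := fun σ => by
    rw [← hs]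
    congr 1
    exact specMap_algHomOf _
  let i : L →ₐ[K] B := algHomOf (j ≫ q)
  have hi : specMap i = j ≫ q := specMap_algHomOf _
  let : Algebra L B := i.toRingHom.toAlgebra
  have hiB : ∀ l, algebraMap L B l = i l := fun l => rfl
  have : IsScalarTower K L B := IsScalarTower.of_algebraMap_eq fun c => (i.commutes c).symm
  have hact : ∀ σ l, act σ (algebraMap L B l) = algebraMap L B (σ l) := fun σ l => by
    have : (act σ).comp i = i.comp (σ : L →ₐ[K] L) := specMap_injective (by
      rw [← specMap_comp, ← specMap_comp, hi, reassoc_of% (hact_j σ), hq, Category.assoc])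
    exact congr($this l)
  -- Applied to the tautological point j, the D-structure becomes a section of Spec B → Spec B[ε],
  -- that is, a derivation of B.
  obtain ⟨t, ht⟩ : ∃ t : prolongSpec K B ⟶ specOver K B, t ≫ j = v.sec j := by
    refine exists_lift j _ ?_
    rw [← range_prolongIncl_comp]
    exact (congr(Set.range ($(v.proj_sec j)).left)).le
  obtain ⟨_, _, rfl⟩ := exists_differential t (by
    rw [← cancel_mono j, Category.assoc, ht, Category.id_comp]
    exact v.proj_sec j)
  obtain ⟨p, hp⟩ : ∃ p : specOver K L ⟶ specOver K B, p ≫ j = P₀ := by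
    refine exists_lift j _ ?_
    rw [hj]
    rintro _ ⟨x, rfl⟩
    refine (hmemN _).2 fun σ => ?_
    have h : (P₀ ≫ τ σ).left x = P₀.left ((specMap (σ : L →ₐ[K] L)).left x) := by
      rw [hP₀]; rfl
    change (P₀ ≫ τ σ).left x ∈ V
    rw [h, left_apply_eq_location]
    exact hPV
  -- `hv` says that this derivation extends the one of L, and `hτv` that it commutes with the Galois
  -- action.
  obtain ⟨Ψ, h1, h2, h3⟩ := hK.exists_equivariant_differential_algHom (L := L) (B := B)
    (fun l => deriv_algHom_of_prolongMap_nablaSpec i (by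
      rw [hi, reassoc_of% ht, hv]) l) act hact
    (fun σ b => deriv_algHom_of_prolongMap_nablaSpec (act σ) (by
      rw [← cancel_mono j, Category.assoc, Category.assoc, hact_j, reassoc_of% ht, ht, ← v.natural,
        hact_j, hτv]) b) (algHomOf p) (fun σ b => by
      have : (algHomOf p).comp (act σ) = (σ : L →ₐ[K] L).comp (algHomOf p) := specMap_injective (by
        rw [← specMap_comp, ← specMap_comp, specMap_algHomOf, ← cancel_mono j, Category.assoc,
          Category.assoc, hact_j, hp, reassoc_of% hp, hP₀])
      exact congr($this b))
  refine ⟨specMap Ψ ≫ j, ?_, fun σ => ?_, ?_⟩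
  · rw [Category.assoc, ← hi, specMap_comp, ← specMap_id]
    congr 1
    exact AlgHom.ext h1
  · rw [Category.assoc, ← hact_j, ← Category.assoc, ← Category.assoc, specMap_comp, specMap_comp]
    congr 2
    exact AlgHom.ext (h2 σ)
  · rw [nabla_specMap Ψ h3, v.natural, nabla, ht]

end EquivariantPoints

/-! ### Twisting by the cocycle and the logarithmic derivative -/

section TorsorPoints

open CartesianMonoidalCategory MonoidalCategory

variable {K L : Type u} [Field K] [CharZero K] [Differential K] [Field L] [Algebra K L]
  [FiniteDimensional K L] [IsGalois K L] [Differential L] [DifferentialAlgebra K L]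
  {G X Y : Over (Spec (CommRingCat.of K))} [GrpObj G] [ModObj G X] [ModObj G Y]
  {sG : DStructure G} {sX : DStructure X} {sY : DStructure Y}

/-- The D-structure on `Y × Spec L` twisted by `h`. -/
def twistedDStructure (sY : DStructure Y) (h : prolongSpec K L ⟶ G) (hh : prolongIncl L ≫ h = 1) :
    DStructure (Y ⊗ specOver K L) where
  sec b := lift ((prolongMap (algHomOf (b ≫ snd _ _)) ≫ h) • sY.sec (b ≫ fst _ _))
    (prolongMap (algHomOf (b ≫ snd _ _)) ≫ nablaSpec L)
  natural φ b := by
    have h1 : algHomOf ((specMap φ ≫ b) ≫ snd _ _) = φ.comp (algHomOf (b ≫ snd _ _)) :=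
      specMap_injective (by
        rw [← specMap_comp, specMap_algHomOf, specMap_algHomOf, Category.assoc])
    rw [h1, ← prolongMap_comp, comp_lift, ModObj.comp_smul, Category.assoc, Category.assoc,
      Category.assoc, sY.natural]
  proj_sec b := by
    have h1 : specMap (algHomOf (b ≫ snd _ _)) = b ≫ snd Y (specOver K L) := specMap_algHomOf _
    have h2 := sY.proj_sec (b ≫ fst _ _)
    rw [tauProj] at h2 ⊢
    rw [comp_lift, ModObj.comp_smul, h2, ← Category.assoc, prolongIncl_prolongMap, Category.assoc,
      hh, MonObj.comp_one, one_smul, reassoc_of% prolongIncl_prolongMap, prolongIncl_nablaSpec,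
      Category.comp_id, h1]
    ext <;> simp

/-- Two D-torsors for the same D-group over a differentially large field that are isomorphic as
torsors have points over `L` with the same Galois cocycle and the same logarithmic derivative. -/
theorem IsDifferentiallyLarge.exists_same_cocycle (hK : IsDifferentiallyLarge K)
    (hX : IsDTorsor sG sX) (hY : IsDTorsor sG sY) (f : X ⟶ Y) [IsModHom G f]
    (x : specOver K L ⟶ X) (h : prolongSpec K L ⟶ G) (hh : h • sX.sec x = nabla x) :
    ∃ y : specOver K L ⟶ Y,
      (∀ (σ : Gal(L/K)) (g : specOver K L ⟶ G), g • x = specMap (σ : L →ₐ[K] L) ≫ x →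
        g • y = specMap (σ : L →ₐ[K] L) ≫ y) ∧ h • sY.sec y = nabla y := by
  have hXt := hX.isAlgTorsor
  have hYv := hY.isAlgTorsor.isVariety
  have hh_one : prolongIncl L ≫ h = 1 := by
    refine hXt.smul_right_cancel (x := x) ?_
    have h1 := congr(prolongIncl L ≫ $hh)
    have h2 := sX.proj_sec x
    rw [tauProj] at h2
    rw [ModObj.comp_smul, h2] at h1
    rw [h1, one_smul]
    exact tauProj_nabla x
  choose g hg using fun σ : Gal(L/K) => hXt.exists_smul_eq x (specMap (σ : L →ₐ[K] L) ≫ x)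
  have hg_mul : ∀ σ ρ : Gal(L/K), (specMap (σ : L →ₐ[K] L) ≫ g ρ) * g σ = g (σ * ρ) := fun σ ρ => by
    refine hXt.smul_right_cancel (x := x) ?_
    rw [mul_smul, hg, hg, ← ModObj.comp_smul, hg, ← Category.assoc, specMap_comp]
    rfl
  have hg_one : g 1 = 1 := by
    refine hXt.smul_right_cancel (x := x) ?_
    rw [hg, one_smul]
    exact (congr($specMap_id ≫ x)).trans (Category.id_comp _)
  -- σ(h)·s_G(g_σ) = ∇(g_σ)·h, from computing ∇(σx) in two ways. This is what makes the twisted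
  -- D-structure invariant under the twisted action.
  have hhg : ∀ σ : Gal(L/K), (prolongMap (σ : L →ₐ[K] L) ≫ h) * sG.sec (g σ) =
      nablaSpec L ≫ g σ * h := fun σ => by
    refine hXt.smul_right_cancel (x := sX.sec x) ?_
    have hσ : ∀ l, (σ : L →ₐ[K] L) l′ = ((σ : L →ₐ[K] L) l)′ :=
      Differential.algHom_deriv' (σ : L →ₐ[K] L) σ.injective
    rw [mul_smul, ← hX.sec_smul, hg, sX.natural, ← ModObj.comp_smul, hh, ← nabla_specMap _ hσ, ← hg,
      mul_smul, hh, nabla, nabla, ModObj.comp_smul]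
  -- The twisted action: its equivariant sections y are those with g_σ·y = σ(y), the cocycle of x.
  obtain ⟨τ, hτf, hτs⟩ : ∃ τ : Gal(L/K) → (Y ⊗ specOver K L ⟶ Y ⊗ specOver K L),
      (∀ σ, τ σ ≫ fst _ _ = (snd Y (specOver K L) ≫ g σ) • fst Y (specOver K L)) ∧
      ∀ σ, τ σ ≫ snd _ _ = snd Y (specOver K L) ≫ specMap (σ : L →ₐ[K] L) :=
    ⟨fun σ => lift _ _, fun σ => lift_fst _ _, fun σ => lift_snd _ _⟩
  have := hYv.locallyOfFiniteType
  have := hYv.isSeparated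
  have := (isVariety_specOver (K := K) (R := L)).locallyOfFiniteType
  have := (isVariety_specOver (K := K) (R := L)).isSeparated
  have : LocallyOfFiniteType (Y ⊗ specOver K L).hom := by
    rw [Over.tensorObj_hom]; infer_instance
  have : IsSeparated (Y ⊗ specOver K L).hom := by
    rw [Over.tensorObj_hom]; infer_instance
  have hmap_one : specMap ((1 : Gal(L/K)) : L →ₐ[K] L) = 𝟙 _ := specMap_id
  have hmap_mul : ∀ σ ρ : Gal(L/K), specMap (σ : L →ₐ[K] L) ≫ specMap (ρ : L →ₐ[K] L) =
    specMap ((σ * ρ : Gal(L/K)) : L →ₐ[K] L) := fun σ ρ => specMap_comp _ _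
  have hτ_one : τ 1 = 𝟙 _ := by
    refine CartesianMonoidalCategory.hom_ext _ _ ?_ ?_
    · rw [hτf, hg_one, MonObj.comp_one, one_smul, Category.id_comp]
    · rw [hτs, hmap_one, Category.id_comp, Category.comp_id]
  have hτ_mul : ∀ σ ρ, τ σ ≫ τ ρ = τ (σ * ρ) := fun σ ρ => by
    refine CartesianMonoidalCategory.hom_ext _ _ ?_ ?_
    · rw [Category.assoc, hτf, ModObj.comp_smul, hτf, hτf, ← Category.assoc, hτs, ← mul_smul,
        ← hg_mul, MonObj.comp_mul, Category.assoc]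
    · rw [Category.assoc, hτs, reassoc_of% (hτs σ), hτs, hmap_mul]
  let v := twistedDStructure sY h hh_one
  have hvf : ∀ {R : Type u} [CommRing R] [Algebra K R] (b : specOver K R ⟶ Y ⊗ specOver K L),
      v.sec b ≫ fst _ _ = (prolongMap (algHomOf (b ≫ snd _ _)) ≫ h) • sY.sec (b ≫ fst _ _) :=
    fun b => lift_fst _ _
  have hvs : ∀ {R : Type u} [CommRing R] [Algebra K R] (b : specOver K R ⟶ Y ⊗ specOver K L),
      v.sec b ≫ snd _ _ = prolongMap (algHomOf (b ≫ snd _ _)) ≫ nablaSpec L :=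
    fun b => lift_snd _ _
  have hvτ : ∀ σ {R : Type u} [CommRing R] [Algebra K R] (b : specOver K R ⟶ Y ⊗ specOver K L),
      v.sec (b ≫ τ σ) = v.sec b ≫ τ σ := fun σ R _ _ b => by
    have h1 : algHomOf ((b ≫ τ σ) ≫ snd _ _) = (algHomOf (b ≫ snd _ _)).comp (σ : L →ₐ[K] L) :=
      specMap_injective (by
        rw [← specMap_comp, specMap_algHomOf, specMap_algHomOf, Category.assoc, Category.assoc,
          hτs])
    have hσ : ∀ l, (σ : L →ₐ[K] L) l′ = ((σ : L →ₐ[K] L) l)′ :=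
      Differential.algHom_deriv' (σ : L →ₐ[K] L) σ.injective
    have h2 : (b ≫ τ σ) ≫ fst _ _ = (specMap (algHomOf (b ≫ snd _ _)) ≫ g σ) • (b ≫ fst _ _) := by
      rw [specMap_algHomOf, Category.assoc, hτf, ModObj.comp_smul, Category.assoc]
    refine CartesianMonoidalCategory.hom_ext _ _ ?_ ?_
    · rw [hvf, h1, h2, ← prolongMap_comp, hY.sec_smul, sG.natural, ← mul_smul, Category.assoc,
        ← MonObj.comp_mul, hhg, Category.assoc, hτf, ModObj.comp_smul, hvf, ← Category.assoc, hvs,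
        ← mul_smul, MonObj.comp_mul, Category.assoc]
    · rw [hvs, h1, ← prolongMap_comp, Category.assoc, prolongMap_nablaSpec _ hσ, Category.assoc,
        hτs, ← Category.assoc, ← Category.assoc, hvs]
  -- The starting point is f(x): since f is equivariant and defined over K, it has the cocycle of x,
  -- though perhaps not its logarithmic derivative.
  obtain ⟨P, hP1, hP2, hP3⟩ := hK.exists_equivariant_sharp (E := Y ⊗ specOver K L) (snd _ _)
    v hvs τ hτ_one hτ_mul hτs hvτ (lift (x ≫ f) (𝟙 _)) (fun σ => by
      refine CartesianMonoidalCategory.hom_ext _ _ ?_ ?_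
      · rw [Category.assoc, hτf, ModObj.comp_smul, lift_fst, lift_snd_assoc, Category.id_comp,
          ← IsModHom.map_smul, hg, Category.assoc, Category.assoc, lift_fst]
      · rw [Category.assoc, hτs, lift_snd_assoc, Category.id_comp, Category.assoc, lift_snd,
          Category.comp_id])
  refine ⟨P ≫ fst _ _, fun σ g' hg' => ?_, ?_⟩
  · obtain rfl : g' = g σ := hXt.smul_right_cancel (hg'.trans (hg σ).symm)
    rw [← Category.assoc, ← hP2 σ, Category.assoc, hτf, ModObj.comp_smul, reassoc_of% hP1]
  · have h1 := congr($hP3 ≫ fst _ _)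
    have h2 : algHomOf (P ≫ snd _ _) = AlgHom.id K L := specMap_injective (by
      rw [specMap_algHomOf, hP1, specMap_id])
    rw [hvf, h2, prolongMap_id, Category.id_comp] at h1
    rw [← h1, nabla, nabla, Category.assoc]

end TorsorPoints

/-! ### Points over finite Galois extensions -/

section GaloisPoints

variable {K : Type u} [Field K]

/-- By the Nullstellensatz the residue field at a maximal ideal of a chart is finite over K; its
normal closure is Galois in characteristic zero. -/
lemma IsVariety.exists_galois_point [CharZero K] {X : Over (Spec (CommRingCat.of K))}
    (hX : IsVariety X) (hne : Nonempty X.left) :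
    ∃ (L : Type u) (_ : Field L) (_ : Algebra K L) (_ : FiniteDimensional K L) (_ : IsGalois K L),
      Nonempty (specOver K L ⟶ X) := by
  obtain ⟨z⟩ := hne
  obtain ⟨V, hV, hz, -⟩ := exists_isAffineOpen_mem_and_subset (x := z) (U := ⊤) trivial
  obtain ⟨R, _, _, j, _, hj, hfin⟩ := exists_chart hV
  have := hfin hX.locallyOfFiniteType
  obtain ⟨p, -⟩ : z ∈ Set.range j.left := hj.ge hz
  have : Nontrivial R := PrimeSpectrum.nonempty_iff_nontrivial.1 ⟨p⟩
  obtain ⟨m, hm⟩ := Ideal.exists_maximal R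
  let k := R ⧸ m
  let : Field k := Ideal.Quotient.field m
  have : Algebra.FiniteType K k := Algebra.FiniteType.of_surjective (Ideal.Quotient.mkₐ K m)
    Ideal.Quotient.mk_surjective
  have : Module.Finite K k := finite_of_finite_type_of_isJacobsonRing K k
  let L := IntermediateField.normalClosure K k (AlgebraicClosure k)
  have : IsGalois K L := ⟨⟩
  exact ⟨L, inferInstance, inferInstance, inferInstance, inferInstance,
    ⟨specMap ((IsScalarTower.toAlgHom K k L).comp (Ideal.Quotient.mkₐ K m)) ≫ j⟩⟩

variable {L : Type u} [Field L] [Algebra K L] [FiniteDimensional K L] [IsGalois K L]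

/-- Two `T`-points of `Spec L` over `K` are locally conjugate under the Galois group. -/
lemma exists_locally_conjugate {T : Over (Spec (CommRingCat.of K))} (a b : T ⟶ specOver K L)
    (x : T.left) : ∃ (U : T.left.Opens) (_ : x ∈ U) (σ : Gal(L/K)),
      (Over.homMk U.ι : Over.mk (U.ι ≫ T.hom) ⟶ T) ≫ b =
        (Over.homMk U.ι : Over.mk (U.ι ≫ T.hom) ⟶ T) ≫ a ≫ specMap (σ : L →ₐ[K] L) := by
  let α : L →+* Γ(T.left, ⊤) := ((Scheme.ΓSpecIso (.of L)).inv ≫ a.left.appTop).hom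
  let β : L →+* Γ(T.left, ⊤) := ((Scheme.ΓSpecIso (.of L)).inv ≫ b.left.appTop).hom
  have hw : ∀ c : T ⟶ specOver K L, CommRingCat.ofHom (algebraMap K L) ≫
      (Scheme.ΓSpecIso (.of L)).inv ≫ c.left.appTop =
      (Scheme.ΓSpecIso (.of K)).inv ≫ T.hom.appTop := fun c => by
    rw [Scheme.ΓSpecIso_inv_naturality_assoc, ← Scheme.Hom.comp_appTop]
    congr 2
    exact Over.w c
  obtain ⟨ε, hε, hεσ⟩ := exists_conjugating_idempotents (K := K) α β fun c =>
    congr($((hw a).trans (hw b).symm) c)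
  -- The ε σ sum to 1 and the stalk is local, so one of them is a unit there; where it is invertible
  -- it can be cancelled.
  obtain ⟨σ, hσ⟩ : ∃ σ, IsUnit (T.left.presheaf.germ ⊤ x trivial (ε σ)) := by
    by_contra! h
    have h1 := congr(T.left.presheaf.germ ⊤ x trivial $hε)
    rw [map_sum, map_one] at h1
    have h2 : (1 : T.left.presheaf.stalk x) ∈ IsLocalRing.maximalIdeal (T.left.presheaf.stalk x) :=
      h1 ▸ Ideal.sum_mem _ fun σ _ => h σ
    exact (Ideal.ne_top_iff_one _).1 (IsLocalRing.maximalIdeal.isMaximal _).ne_top h2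
  refine ⟨T.left.basicOpen (ε σ), (Scheme.mem_basicOpen_top _ _ _).2 hσ, σ, ?_⟩
  set U := T.left.basicOpen (ε σ)
  have hunit : IsUnit (U.ι.appTop (ε σ)) := by
    refine RingedSpace.isUnit_of_isUnit_germ _ ⊤ _ fun y _ => ?_
    refine (Scheme.mem_basicOpen_top _ _ _).1 ?_
    rw [← Scheme.preimage_basicOpen_top]
    exact y.2
  ext1
  have : IsAffine (specOver K L).left := inferInstanceAs (IsAffine (Spec _))
  refine ext_of_isAffine ?_
  rw [← cancel_epi (Scheme.ΓSpecIso (.of L)).inv]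
  ext l
  have h1 := congr(U.ι.appTop $(hεσ σ l))
  rw [map_mul, map_mul] at h1
  have h2 := hunit.mul_left_cancel h1
  refine h2.trans ?_
  change _ = ((Scheme.ΓSpecIso (.of L)).inv ≫
    (U.ι ≫ a.left ≫ Spec.map (CommRingCat.ofHom (σ : L →+* L))).appTop) l
  rw [Scheme.Hom.comp_appTop, Scheme.Hom.comp_appTop, Category.assoc,
    ← Scheme.ΓSpecIso_inv_naturality_assoc]
  rfl

end GaloisPoints

/-! ### Descent of the map g·x ↦ g·y -/

section Descent

open CartesianMonoidalCategory MonoidalCategory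

variable {K L : Type u} [Field K] [Field L] [Algebra K L] [FiniteDimensional K L] [IsGalois K L]
  {G X Y : Over (Spec (CommRingCat.of K))} [GrpObj G] [ModObj G X] [ModObj G Y]

/-- Over L the map is clear. Equality of the cocycles makes it independent of the chosen T-point of
Spec L, so it descends along the flat cover X × Spec L → X. -/
lemma exists_hom_of_same_cocycle (hX : IsAlgTorsor G X)
    (x : specOver K L ⟶ X) (y : specOver K L ⟶ Y)
    (hxy : ∀ (σ : Gal(L/K)) (g : specOver K L ⟶ G), g • x = specMap (σ : L →ₐ[K] L) ≫ x →
        g • y = specMap (σ : L →ₐ[K] L) ≫ y) :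
    ∃ φ : X ⟶ Y, ∀ (T : Over (Spec (CommRingCat.of K))) (g : T ⟶ G) (a : T ⟶ specOver K L),
      (g • (a ≫ x)) ≫ φ = g • (a ≫ y) := by
  -- Locally a′ is the σ-conjugate of a, so g = g′·g_σ by freeness of the action on X; the same g_σ
  -- relates the conjugates of y.
  have key : ∀ {T : Over (Spec (CommRingCat.of K))} (g g' : T ⟶ G) (a a' : T ⟶ specOver K L),
      g • (a ≫ x) = g' • (a' ≫ x) → g • (a ≫ y) = g' • (a' ≫ y) := fun {T} g g' a a' h => by
    ext1
    refine Scheme.hom_ext_of_forall _ _ fun z => ?_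
    obtain ⟨U, hzU, σ, hσ⟩ := exists_locally_conjugate a a' z
    refine ⟨U, hzU, ?_⟩
    set u : Over.mk (U.ι ≫ T.hom) ⟶ T := Over.homMk U.ι
    obtain ⟨gσ, hgσ⟩ := hX.exists_smul_eq x (specMap (σ : L →ₐ[K] L) ≫ x)
    have hconj : ∀ {Z : Over (Spec (CommRingCat.of K))} [ModObj G Z] (w : specOver K L ⟶ Z),
        gσ • w = specMap (σ : L →ₐ[K] L) ≫ w → (u ≫ a ≫ gσ) • (u ≫ a ≫ w) = u ≫ a' ≫ w :=
      fun w hw => by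
        rw [← ModObj.comp_smul, ← ModObj.comp_smul, hw, ← Category.assoc, ← Category.assoc,
          Category.assoc u, ← hσ, Category.assoc]
    have h1 : u ≫ g = (u ≫ g') * (u ≫ a ≫ gσ) := by
      refine hX.smul_right_cancel (x := u ≫ a ≫ x) ?_
      rw [← ModObj.comp_smul, h, mul_smul, hconj x hgσ, ModObj.comp_smul]
    have h2 : u ≫ (g • (a ≫ y)) = u ≫ (g' • (a' ≫ y)) := by
      rw [ModObj.comp_smul, h1, mul_smul, hconj y (hxy σ gσ hgσ), ModObj.comp_smul]
    exact congr(($h2).left)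
  obtain ⟨c, hc⟩ := hX.exists_smul_eq (snd X (specOver K L) ≫ x) (fst X (specOver K L))
  let Φ : X ⊗ specOver K L ⟶ Y := c • (snd _ _ ≫ y)
  let pr := (fst X (specOver K L)).left
  have hKL : EffectiveEpi pr := by
    have h1 : Flat (specOver K L).hom := by
      change Flat (Spec.map _)
      rw [Flat.SpecMap_iff]
      exact RingHom.flat_algebraMap_iff.2 inferInstance
    have h2 : Surjective (specOver K L).hom :=
      ⟨Function.surjective_to_subsingleton (α := PrimeSpectrum L) (β := PrimeSpectrum K) _⟩
    have h3 : QuasiCompact (specOver K L).hom :=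
      (isVariety_specOver (K := K) (R := L)).quasiCompact
    simp only [pr, Over.fst_left]
    infer_instance
  have hΦ : ∀ {Z : Scheme} (g₁ g₂ : Z ⟶ (X ⊗ specOver K L).left), g₁ ≫ pr = g₂ ≫ pr →
      g₁ ≫ Φ.left = g₂ ≫ Φ.left := fun {Z} g₁ g₂ h => by
    have hw : g₂ ≫ (X ⊗ specOver K L).hom = g₁ ≫ (X ⊗ specOver K L).hom := by
      rw [← Over.w (fst X (specOver K L)), ← Category.assoc, ← Category.assoc]
      exact congr($h.symm ≫ _)
    let t₁ : Over.mk (g₁ ≫ (X ⊗ specOver K L).hom) ⟶ X ⊗ specOver K L := Over.homMk g₁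
    let t₂ : Over.mk (g₁ ≫ (X ⊗ specOver K L).hom) ⟶ X ⊗ specOver K L := Over.homMk g₂ hw
    have ht : t₁ ≫ fst _ _ = t₂ ≫ fst _ _ := by
      ext1
      exact h
    have := key (t₁ ≫ c) (t₂ ≫ c) (t₁ ≫ snd _ _) (t₂ ≫ snd _ _) (by
      rw [Category.assoc, Category.assoc, ← ModObj.comp_smul, ← ModObj.comp_smul, hc, ht])
    rw [Category.assoc, Category.assoc, ← ModObj.comp_smul, ← ModObj.comp_smul] at this
    exact congr(($this).left)
  have hfac := EffectiveEpi.fac pr Φ.left hΦ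
  let φ : X ⟶ Y := Over.homMk (EffectiveEpi.desc pr Φ.left hΦ) (by
    rw [← cancel_epi pr, reassoc_of% hfac, Over.w]
    exact (Over.w (fst X (specOver K L))).symm)
  have hφ : fst _ _ ≫ φ = Φ := by
    ext1
    exact hfac
  refine ⟨φ, fun T g a => ?_⟩
  have h1 : lift (g • (a ≫ x)) a ≫ Φ = (g • (a ≫ x)) ≫ φ := by
    rw [← hφ, lift_fst_assoc]
  rw [← h1, ModObj.comp_smul, lift_snd_assoc]
  refine key _ _ _ _ ?_
  have h2 := congr(lift (g • (a ≫ x)) a ≫ $hc)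
  rwa [ModObj.comp_smul, lift_snd_assoc, lift_fst] at h2

end Descent

/-! ### Morphisms of schemes induce differential morphisms -/

section RegularFunctions

variable {K : Type u} [Field K] {X Y : Over (Spec (CommRingCat.of K))}

lemma LiesIn.of_location_mem {R : Type u} [Field R] [Algebra K R] {a : specOver K R ⟶ X}
    {W : X.left.Opens} (h : location a ∈ W) : LiesIn a W := fun x _ => by
  change a.left x ∈ W
  rwa [left_apply_eq_location]

lemma LiesIn.comp {R : Type u} [CommRing R] [Algebra K R] {a : specOver K R ⟶ X}
    {W : X.left.Opens} (h : LiesIn a W) (φ : X ⟶ Y) {V : Y.left.Opens} (hWV : W ≤ φ.left ⁻¹ᵁ V) :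
    LiesIn (a ≫ φ) V :=
  fun _ hx => hWV (h hx)

lemma valueAt_comp {R : Type u} [CommRing R] [Algebra K R] {a : specOver K R ⟶ X}
    {W : X.left.Opens} (h : LiesIn a W) (φ : X ⟶ Y) {V : Y.left.Opens} (hWV : W ≤ φ.left ⁻¹ᵁ V)
    (r : Γ(Y.left, V)) :
    valueAt (a ≫ φ) V (h.comp φ hWV) r = valueAt a W h (φ.left.appLE V W hWV r) := by
  have := Scheme.Hom.appLE_comp_appLE a.left φ.left V W ⊤ hWV h
  exact congr((Scheme.ΓSpecIso (CommRingCat.of R)).hom ($this.symm r))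

/-- A map between sets of points induced by a morphism of schemes is a differential morphism. -/
lemma isDifferentialMorphism_of_hom {U : Type u} [Field U] [Differential U] [Algebra K U]
    {S : Set (specOver K U ⟶ X)} {T : Set (specOver K U ⟶ Y)} (F : S → T) (φ : X ⟶ Y)
    (hF : ∀ a, (F a).1 = a.1 ≫ φ) : IsDifferentialMorphism F := by
  intro a V hV ha r
  have hloc : location a.1 ∈ φ.left ⁻¹ᵁ V := by
    have : IsLocalRing.closedPoint U ∈ (F a).1.left ⁻¹ᵁ V := ha trivial
    rwa [hF] at this
  obtain ⟨W, hW, haW, hWV⟩ := exists_isAffineOpen_mem_and_subset hloc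
  -- One function, the pullback of r, with P its order-zero variable and Q = 1.
  refine ⟨W, hW, .of_location_mem haW, 1, fun _ => φ.left.appLE V W hWV r, .X (0, 0), 1, ?_, ?_⟩
  · simp [diffEval]
  · intro b hb _
    have hbV : LiesIn (F b).1 V := by
      rw [hF]
      exact hb.comp φ hWV
    refine ⟨hbV, ?_⟩
    have hval : valueAt (F b).1 V hbV r = valueAt (b.1 ≫ φ) V (hb.comp φ hWV) r := by
      congr 1
      exact hF b
    rw [hval, valueAt_comp hb φ hWV]
    simp [diffEval]

end RegularFunctions

/-! ### Transfer of sharp points and the final isomorphism -/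

section SharpPoints

variable {K : Type u} [Field K] [Differential K]
  {U : Type u} [Field U] [Differential U] [Algebra K U] [DifferentialAlgebra K U]
  {G X Y : Over (Spec (CommRingCat.of K))}

variable {L : Type u} [Field L] [Algebra K L] [Differential L] [DifferentialAlgebra K L]
  [GrpObj G] [ModObj G X] [ModObj G Y]
  {sG : DStructure G} {sX : DStructure X} {sY : DStructure Y}

/-- Sharpness of g·x amounts to s_G(g) = ∇(g)·h, by freeness of the action on X; this depends on x
only through h. -/
lemma smul_mem_sharp_of_same_logDeriv (hX : IsDTorsor sG sX) (hY : IsDTorsor sG sY)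
    {x : specOver K L ⟶ X} {y : specOver K L ⟶ Y} {h : prolongSpec K L ⟶ G}
    (hx : h • sX.sec x = nabla x) (hy : h • sY.sec y = nabla y)
    (e : L →ₐ[K] U) (he : ∀ l, e l′ = (e l)′) {g : specOver K U ⟶ G}
    (hg : g • (specMap e ≫ x) ∈ sharp U sX) : g • (specMap e ≫ y) ∈ sharp U sY := by
  have hnabla : ∀ {Z : Over (Spec (CommRingCat.of K))} [ModObj G Z] (z : specOver K U ⟶ Z),
      nabla (g • z) = nabla g • nabla z := fun z => ModObj.comp_smul _ _ _
  have hgG : sG.sec g = nabla g * (prolongMap e ≫ h) := by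
    refine hX.isAlgTorsor.smul_right_cancel (x := sX.sec (specMap e ≫ x)) ?_
    rw [mul_smul, ← hX.sec_smul, show sX.sec _ = nabla _ from hg, hnabla, sX.natural,
      ← ModObj.comp_smul, hx, nabla_specMap e he]
  change sY.sec _ = nabla _
  rw [hY.sec_smul, hgG, mul_smul, sY.natural, ← ModObj.comp_smul, hy, hnabla, nabla_specMap e he]

end SharpPoints

end DiffAlg

end

theorem corollary3p3 {K : Type u} [Field K] [CharZero K] [Differential K]
    (hK : DiffAlg.IsDifferentiallyLarge K)
    {U : Type u} [Field U] [Differential U] [Algebra K U] [DifferentialAlgebra K U]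
    (hU : DiffAlg.IsDifferentiallyClosed U)
    {G X Y : Over (Spec (CommRingCat.of K))} [GrpObj G] [ModObj G X] [ModObj G Y]
    {sG : DiffAlg.DStructure G} {sX : DiffAlg.DStructure X} {sY : DiffAlg.DStructure Y}
    (hG : DiffAlg.IsDGroup sG) (hX : DiffAlg.IsDTorsor sG sX) (hY : DiffAlg.IsDTorsor sG sY)
    (hf : ∃ f : X ≅ Y, IsModHom G f.hom) :
    ∃ g : DiffAlg.sharp U sX ≃ DiffAlg.sharp U sY,
      DiffAlg.IsDifferentialMorphism (g : DiffAlg.sharp U sX → DiffAlg.sharp U sY) ∧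
      DiffAlg.IsDifferentialMorphism (g.symm : DiffAlg.sharp U sY → DiffAlg.sharp U sX) ∧
      ∀ (v : DiffAlg.sharp U sG) (x : DiffAlg.sharp U sX),
        g (hX.sharpSMul v x) = hY.sharpSMul v (g x) := by
  obtain ⟨f, _⟩ := hf
  have hXt := hX.isAlgTorsor
  have hYt := hY.isAlgTorsor
  obtain ⟨L, _, _, _, _, ⟨x⟩⟩ := hXt.isVariety.exists_galois_point hXt.nonempty
  let : Differential L := Differential.differentialFiniteDimensional K L
  have : DifferentialAlgebra K L := Differential.differentialAlgebraFiniteDimensional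
  obtain ⟨h, hx⟩ := hXt.exists_smul_eq (sX.sec x) (DiffAlg.nabla x)
  obtain ⟨y, hxy, hy⟩ := hK.exists_same_cocycle hX hY f.hom x h hx
  obtain ⟨φ, hφ⟩ := DiffAlg.exists_hom_of_same_cocycle hXt x y hxy
  obtain ⟨φ', hφ'⟩ := DiffAlg.exists_hom_of_same_cocycle hYt y x fun σ g hg => by
    obtain ⟨g', hg'⟩ := hXt.exists_smul_eq x (DiffAlg.specMap (σ : L →ₐ[K] L) ≫ x)
    obtain rfl : g = g' := hYt.smul_right_cancel (hg.trans (hxy σ g' hg').symm)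
    exact hg'
  have : CharZero U := charZero_of_injective_algebraMap (algebraMap K U).injective
  have := hU.isAlgClosed
  -- The embedding is automatically differential, since derivations extend uniquely to algebraic
  -- extensions in characteristic zero. Every U-point of X is then g·e(x), where φ is explicit.
  let e : L →ₐ[K] U := IsAlgClosed.lift
  have he : ∀ l, e l′ = (e l)′ := Differential.algHom_deriv' e e.injective
  refine ⟨⟨fun a => ⟨a.1 ≫ φ, ?_⟩, fun b => ⟨b.1 ≫ φ', ?_⟩, fun a => Subtype.ext ?_,
    fun b => Subtype.ext ?_⟩, DiffAlg.isDifferentialMorphism_of_hom _ φ fun _ => rfl,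
    DiffAlg.isDifferentialMorphism_of_hom _ φ' fun _ => rfl, fun v a => Subtype.ext ?_⟩
  · obtain ⟨a, ha⟩ := a
    obtain ⟨g, rfl⟩ := hXt.exists_smul_eq (DiffAlg.specMap e ≫ x) a
    dsimp only
    rw [hφ]
    exact DiffAlg.smul_mem_sharp_of_same_logDeriv hX hY hx hy e he ha
  · obtain ⟨b, hb⟩ := b
    obtain ⟨g, rfl⟩ := hYt.exists_smul_eq (DiffAlg.specMap e ≫ y) b
    dsimp only
    rw [hφ']
    exact DiffAlg.smul_mem_sharp_of_same_logDeriv hY hX hy hx e he hb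
  · obtain ⟨a, ha⟩ := a
    obtain ⟨g, rfl⟩ := hXt.exists_smul_eq (DiffAlg.specMap e ≫ x) a
    dsimp only
    rw [hφ, hφ']
  · obtain ⟨b, hb⟩ := b
    obtain ⟨g, rfl⟩ := hYt.exists_smul_eq (DiffAlg.specMap e ≫ y) b
    dsimp only
    rw [hφ', hφ]
  · obtain ⟨a, ha⟩ := a
    obtain ⟨g, rfl⟩ := hXt.exists_smul_eq (DiffAlg.specMap e ≫ x) a
    change (v.1 • g • (DiffAlg.specMap e ≫ x)) ≫ φ = v.1 • (g • (DiffAlg.specMap e ≫ x)) ≫ φ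
    rw [hφ, ← mul_smul, hφ, mul_smul]
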